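/- Let $f\colon M^4\to\mathbb R^{4+r}$ be a smooth immersion of a smooth $4$-manifold, with the induced metric $g$, and let $\mathrm{II}_\nu(X,Y)=\nu\cdot\mathrm{II}(X,Y)$ be the second fundamental form in the direction of a normal vector $\nu$. Let $|\mathrm{II}_p|$ be the space of quadratic forms on $T_pM$ spanned by the $\mathrm{II}_\nu$ with $\nu$ normal at $p$. $M$ is *austere* if, for every normal vector $\nu$, the eigenvalues of $\mathrm{II}_\nu$ with respect to $g$ are symmetric about $0$ (with multiplicities). Put $$\mathcal Q_A=\left\{\begin{bmatrix}A&B\\B&-A\end{bmatrix}: A,B \text{ symmetric real } 2\times2\right\},\quad J_0=\begin{bmatrix}0&0&-1&0\\0&0&0&-1\\1&0&0&0\\0&1&0&0\end{bmatrix},\quad T=\begin{bmatrix}0&-1&0&0\\1&0&0&0\\0&0&0&1\\0&0&-1&0\end{bmatrix},\quad U=-J_0T .$$ An austere $M$ is of *type A* if at every $p$ the space $|\mathrm{II}_p|$ is $O(4)$-conjugate to a subspace of $\mathcal Q_A$, i.e. there is an orthonormal basis $e(p)=(e_1,\dots,e_4)$ of $T_pM$ in which the matrices of the forms in $|\mathrm{II}_p|$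 form a subspace $\mathcal Q(p)\subset\mathcal Q_A$. Let $M$ be an austere $4$-fold of type A, and for every $p\in M$ choose such a basis $e(p)$, with the resulting subspace $\mathcal Q(p)\subset\mathcal Q_A$. Let $J_p\colon T_pM\to T_pM$ be the endomorphism with matrix $J_0$ in the basis $e(p)$. Define $\mathsf K(S)=([S,T]\,|\,[S,U])$, a $4\times 8$ matrix for each $4\times4$ matrix $S$, and suppose that for every $p\in M$ the only vector of $\mathbb R^8$ annihilated by all the matrices $\mathsf K(S)$, $S\in\mathcal Q(p)$, is $0$. Then: 1. If $J$ is continuous on $M$ (so that it is an almost complex structure), then $M$ is Kähler with respect to $J$: $J$ is smooth, $J^2=-1$, $J$ is orthogonal for $g$, and $\nabla J=0$ for the Levi-Civita connection $\nabla$ of $g$. 2. If only the bases $e(p)$ at nearby points induce the same orientation of $M$, then every $p\in M$ has an open neighbourhood $V$ and an endomorphism field $J'$ on $V$ with $J'_q\in\{J_q,-J_q\}$ for all $q\in V$ such that $V$ is Kähler with respect to $J'$. -/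

import Mathlib

open scoped Manifold ContDiff Topology

namespace AustereFourfold

noncomputable section

/-- The Euclidean space in which the submanifold lies. -/
abbrev Ambient (r : ℕ) : Type := EuclideanSpace ℝ (Fin (4 + r))

/-- The tangent space at `p` of a 4-manifold. -/
abbrev Tan {M : Type*} [TopologicalSpace M] [ChartedSpace (EuclideanSpace ℝ (Fin 4)) M]
    (p : M) : Type :=
  TangentSpace (𝓡 4) p

section Geometry

variable {M : Type*} [TopologicalSpace M] [ChartedSpace (EuclideanSpace ℝ (Fin 4)) M]
  {r : ℕ}

/-- The differential `df_p`, with values in the ambient Euclidean space. The metric of `M` is the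
induced one: `g_p(u, v) = ⟪df_p u, df_p v⟫`. -/
def push (f : M → Ambient r) (p : M) : Tan p →L[ℝ] Ambient r :=
  mfderiv (𝓡 4) (𝓡 (4 + r)) f p

/-- A smooth immersion of a 4-manifold into `ℝ^{4+r}`. -/
def IsSmoothImmersion (f : M → Ambient r) : Prop :=
  ContMDiff (𝓡 4) (𝓡 (4 + r)) ∞ f ∧ ∀ p, Function.Injective (push f p)

/-- The image `df_p(T_pM)`. -/
def tangentPlane (f : M → Ambient r) (p : M) : Submodule ℝ (Ambient r) :=
  LinearMap.range (push f p).toLinearMap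

/-- The second fundamental form `II_p(u, v) = π_N ∇_u V`: here `V` is the extension of `v` with
constant coordinates in the preferred chart at `p` (the chart that identifies `T_pM` with `ℝ⁴`),
so that the Euclidean derivative of `df(V)` along `u` is the second derivative of `f` in that
chart. -/
def secondForm (f : M → Ambient r) (p : M) (u v : Tan p) : Ambient r :=
  (tangentPlane f p)ᗮ.starProjection
    (fderiv ℝ (fderiv ℝ (f ∘ (extChartAt (𝓡 4) p).symm)) (extChartAt (𝓡 4) p p) u v)

/-- `b` is an orthonormal basis of `T_pM` for the induced metric. -/
def IsOrthonormalFrame (f : M → Ambient r) (p : M) (b : Fin 4 → Tan p) : Prop :=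
  Orthonormal ℝ fun i => push f p (b i)

/-- The matrix `ν · II(b_i, b_j)` of the quadratic form `II_ν` in the frame `b`. -/
def secondFormMatrix (f : M → Ambient r) (p : M) (b : Fin 4 → Tan p) (ν : Ambient r) :
    Matrix (Fin 4) (Fin 4) ℝ :=
  Matrix.of fun i j => inner ℝ ν (secondForm f p (b i) (b j))

/-- The space `|II_p|` spanned by the quadratic forms `II_ν`, `ν` normal at `p`, in the frame
`b`. When `b` runs over the orthonormal frames at `p`, these are exactly the subspaces of the
symmetric matrices to which `|II_p|` is `O(4)`-conjugate. -/
def secondFormSpace (f : M → Ambient r) (p : M) (b : Fin 4 → Tan p) :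
    Submodule ℝ (Matrix (Fin 4) (Fin 4) ℝ) :=
  Submodule.span ℝ {S | ∃ ν ∈ (tangentPlane f p)ᗮ, S = secondFormMatrix f p b ν}

/-- Austere: for every normal vector the eigenvalues of `II_ν` with respect to the metric,
counted with multiplicity, are symmetric about zero. -/
def IsAustere (f : M → Ambient r) : Prop :=
  ∀ p, ∀ ν ∈ (tangentPlane f p)ᗮ, ∀ b : Fin 4 → Tan p, IsOrthonormalFrame f p b →
    (secondFormMatrix f p b ν).charpoly.roots.map (fun t => -t) =
      (secondFormMatrix f p b ν).charpoly.roots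

/-- The maximal austere space `Q_A` of the matrices `[A B; B -A]` with `A`, `B` symmetric
`2 × 2` matrices. -/
def QA : Set (Matrix (Fin 4) (Fin 4) ℝ) :=
  {S | ∃ A B : Matrix (Fin 2) (Fin 2) ℝ, A.IsSymm ∧ B.IsSymm ∧
    S = Matrix.reindex finSumFinEquiv finSumFinEquiv (Matrix.fromBlocks A B B (-A))}

/-- The orthonormal frame `b` at `p` conjugates `|II_p|` to a subspace of `Q_A`. -/
def IsTypeAFrame (f : M → Ambient r) (p : M) (b : Fin 4 → Tan p) : Prop :=
  IsOrthonormalFrame f p b ∧ (secondFormSpace f p b : Set (Matrix (Fin 4) (Fin 4) ℝ)) ⊆ QA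

/-- An austere 4-fold of type A. -/
def IsTypeA (f : M → Ambient r) : Prop :=
  IsAustere f ∧ ∀ p, ∃ b : Fin 4 → Tan p, IsTypeAFrame f p b

/-- The complex structure of `ℝ⁴` that anticommutes with `Q_A`. -/
def stdJ : Matrix (Fin 4) (Fin 4) ℝ :=
  !![0, 0, -1, 0; 0, 0, 0, -1; 1, 0, 0, 0; 0, 1, 0, 0]

/-- The skew matrix `T`. -/
def matT : Matrix (Fin 4) (Fin 4) ℝ :=
  !![0, -1, 0, 0; 1, 0, 0, 0; 0, 0, 0, 1; 0, 0, -1, 0]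

/-- The skew matrix `U = -J T`. -/
def matU : Matrix (Fin 4) (Fin 4) ℝ :=
  !![0, 0, 0, 1; 0, 0, -1, 0; 0, 1, 0, 0; -1, 0, 0, 0]

/-- The map `K : S ↦ ([S,T] | [S,U])` to `4 × 8` matrices. -/
def mapK (S : Matrix (Fin 4) (Fin 4) ℝ) : Matrix (Fin 4) (Fin 4 ⊕ Fin 4) ℝ :=
  Matrix.fromCols (S * matT - matT * S) (S * matU - matU * S)

/-- The matrices in the image of `Q` under `K` have no common null vector except zero. -/
def HasTrivialCommonNullspace (Q : Submodule ℝ (Matrix (Fin 4) (Fin 4) ℝ)) : Prop :=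
  ∀ x : Fin 4 ⊕ Fin 4 → ℝ, (∀ S ∈ Q, (mapK S).mulVec x = 0) → x = 0

/-- The endomorphism of `T_pM` with matrix `J` in the orthonormal frame `b`: it sends
`v = ∑_j g(v, b_j) b_j` to `∑_{i,j} g(v, b_j) J_{ij} b_i`. -/
def frameJ (f : M → Ambient r) (p : M) (b : Fin 4 → Tan p) : Tan p →L[ℝ] Tan p :=
  ∑ j, ((innerSL ℝ (push f p (b j))).comp (push f p)).smulRight (∑ i, stdJ i j • b i)

/-- A field of endomorphisms of the tangent spaces, as a section of the bundle `End(TM)`. -/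
def endSection (J : ∀ p : M, Tan p →L[ℝ] Tan p) (p : M) :
    Bundle.TotalSpace (EuclideanSpace ℝ (Fin 4) →L[ℝ] EuclideanSpace ℝ (Fin 4))
      (fun q : M => TangentSpace (𝓡 4) q →L[ℝ] TangentSpace (𝓡 4) q) :=
  ⟨p, J p⟩

/-- The Levi-Civita connection `∇_u Y` of the induced metric: the tangent vector whose image
under `df_p` is the tangential part of the Euclidean derivative of `df(Y)` along `u`. -/
def leviCivita (f : M → Ambient r) (Y : ∀ q : M, Tan q) (p : M) (u : Tan p) : Tan p :=
  Function.invFun (push f p)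
    ((tangentPlane f p).starProjection
      (mfderiv (𝓡 4) (𝓡 (4 + r)) (fun q => push f q (Y q)) p u))

/-- The open submanifold `U` of `M`, with the induced metric, is Kähler with respect to `J`:
`J` is a smooth almost complex structure on `U`, orthogonal for the metric, and parallel for the
Levi-Civita connection. -/
structure IsKaehlerOn [IsManifold (𝓡 4) ∞ M] (f : M → Ambient r)
    (J : ∀ p : M, Tan p →L[ℝ] Tan p) (U : Set M) : Prop where
  smooth : ContMDiffOn (𝓡 4)
    ((𝓡 4).prod 𝓘(ℝ, EuclideanSpace ℝ (Fin 4) →L[ℝ] EuclideanSpace ℝ (Fin 4))) ∞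
    (endSection J) U
  sq_eq : ∀ p ∈ U, ∀ v : Tan p, J p (J p v) = -v
  orthogonal : ∀ p ∈ U, ∀ u v : Tan p,
    inner ℝ (push f p (J p u)) (push f p (J p v)) = inner ℝ (push f p u) (push f p v)
  parallel : ∀ p ∈ U, ∀ Y : ∀ q : M, Tan q,
    ContMDiffAt (𝓡 4) (𝓡 4).tangent ∞
      (fun q => (⟨q, Y q⟩ : TangentBundle (𝓡 4) M)) p →
    ∀ u : Tan p, leviCivita f (fun q => J q (Y q)) p u = J p (leviCivita f Y p u)

/-- Frames at nearby points induce the same orientation: for `q` near `p`, the Gram matrix of the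
frame at `p` against the frame at `q` has positive determinant. -/
def LocallyCooriented (f : M → Ambient r) (e : ∀ p : M, Fin 4 → Tan p) : Prop :=
  ∀ p, ∀ᶠ q in 𝓝 p,
    0 < (Matrix.of fun i j => inner ℝ (push f p (e p i)) (push f q (e q j)) :
      Matrix (Fin 4) (Fin 4) ℝ).det

end Geometry

end

end AustereFourfold

open scoped Matrix

namespace AustereFourfold

noncomputable section

/-! Every matrix in `Q_A` anticommutes with `J`, so the normal-valued second fundamental form
satisfies II(Jy, z) = II(y, Jz). Suppose first that `J` is differentiable. Differentiating J² = -1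
and the skewness of `J` shows that each ∇_k J is skew and anticommutes with `J`, hence ∇_k J = t_k T
+ u_k U. Differentiating the identity for II along e_k relates these coefficients to ∇II, which is
totally symmetric by Codazzi. Taking traces eliminates ∇II and leaves K(S)(u, -t) = 0 for every S in
`Q(p)`, so the nullspace hypothesis gives t = u = 0. This is `covDerivEnd_eq_zero`, resting on
`codazzi_covDerivEnd` and `mapK_mulVec_eq_zero`.

Smoothness has to be produced, because the frames need not vary continuously. In a smooth
orthonormal frame, the orthogonal complex structures with Pfaffian of one sign form the unit sphere
in the span of J, T, U (`exists_eq_quatMat`). Anticommuting with II is a homogeneous linear system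
for the three coefficients, with smooth coefficients. The nullspace hypothesis also makes its T and
U columns independent at the given point (`exists_independent_anticommRow`), so nearby the solutions
lie on a line spanned by a smooth cross product. Normalizing it gives a smooth field equal to ±J at
each point (`exists_smooth_adapted`). Continuity of `J` fixes the sign; coorientation alone only
fixes the sign of the Pfaffian, which is why the second claim allows a choice of sign. The argument
for ∇J = 0 does not depend on that sign.

The local computation takes place in the preferred chart at a point, where `f` is an immersion `F`
between Euclidean spaces. -/

/-! ### Matrix algebra of J, T, U and Q_A. -/

/-- Skew matrices anticommuting with `J` are combinations of `T` and `U`. -/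
theorem exists_eq_add_of_skew_of_anticomm {N : Matrix (Fin 4) (Fin 4) ℝ}
    (hs : Nᵀ = -N) (hJ : N * stdJ + stdJ * N = 0) : ∃ t u : ℝ, N = t • matT + u • matU := by
  have hs' : ∀ i j, N j i = -N i j := fun i j => congrFun (congrFun hs i) j
  have hJ' : ∀ i j, (N * stdJ + stdJ * N) i j = 0 := fun i j => congrFun (congrFun hJ i) j
  simp only [Matrix.add_apply, Matrix.mul_apply, Fin.sum_univ_four] at hJ'
  refine ⟨N 1 0, N 2 1, ?_⟩
  have e1 := hJ' 0 0
  have e2 := hJ' 0 1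
  have e3 := hJ' 0 2
  have e4 := hJ' 0 3
  have e5 := hJ' 1 0
  have e6 := hJ' 1 1
  have e7 := hJ' 1 2
  have e8 := hJ' 1 3
  simp [stdJ] at e1 e2 e3 e4 e5 e6 e7 e8
  have h00 := hs' 0 0
  have h11 := hs' 1 1
  have h22 := hs' 2 2
  have h33 := hs' 3 3
  have h01 := hs' 0 1
  have h02 := hs' 0 2
  have h03 := hs' 0 3
  have h12 := hs' 1 2
  have h13 := hs' 1 3
  have h23 := hs' 2 3
  ext i j
  fin_cases i <;> fin_cases j <;> simp [matT, matU] <;> linarith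

/-- The Pfaffian of a `4 × 4` matrix. -/
def pfaffian (N : Matrix (Fin 4) (Fin 4) ℝ) : ℝ :=
  N 0 1 * N 2 3 - N 0 2 * N 1 3 + N 0 3 * N 1 2

/-- The Pfaffian is multiplied by the determinant under congruence, and Pf(J) = -1. It thus detects
the orientation of the frame that defines `J`. -/
theorem pfaffian_conj_stdJ (R : Matrix (Fin 4) (Fin 4) ℝ) :
    pfaffian (R * stdJ * R.transpose) = -R.det := by
  rw [Matrix.det_succ_row_zero]
  simp [pfaffian, Matrix.mul_apply, Fin.sum_univ_four, stdJ, Matrix.det_fin_three, Fin.succAbove]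
  ring

/-- The span of `J`, `T`, `U`. -/
def quatMat (c : Fin 3 → ℝ) : Matrix (Fin 4) (Fin 4) ℝ :=
  c 0 • stdJ + c 1 • matT + c 2 • matU

theorem eq_zero_of_sum_sq_eq_zero {a b c : ℝ} (h : a ^ 2 + b ^ 2 + c ^ 2 = 0) :
    a = 0 ∧ b = 0 ∧ c = 0 :=
  ⟨by nlinarith [sq_nonneg b, sq_nonneg c], by nlinarith [sq_nonneg a, sq_nonneg c],
    by nlinarith [sq_nonneg a, sq_nonneg b]⟩

/-- Such an `N` has Pfaffian ±1; the value -1 makes its self-dual part vanish, leaving a unit vector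
of the anti-self-dual space spanned by J, T, U. -/
theorem exists_eq_quatMat {N : Matrix (Fin 4) (Fin 4) ℝ} (hs : Nᵀ = -N) (hN : N * N = -1)
    (hp : pfaffian N < 0) :
    ∃ c : Fin 3 → ℝ, N = quatMat c ∧ c 0 ^ 2 + c 1 ^ 2 + c 2 ^ 2 = 1 := by
  have hs' : ∀ i j, N j i = -N i j := fun i j => congrFun (congrFun hs i) j
  have hN' : ∀ i j, (N * N) i j = (-1 : Matrix (Fin 4) (Fin 4) ℝ) i j :=
    fun i j => congrFun (congrFun hN i) j
  simp only [Matrix.mul_apply, Fin.sum_univ_four] at hN'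
  have e0 := hN' 0 0
  have e1 := hN' 1 1
  have e2 := hN' 2 2
  have e3 := hN' 3 3
  have f1 := hN' 0 1
  have f2 := hN' 0 2
  have f3 := hN' 0 3
  have f4 := hN' 1 2
  have f5 := hN' 1 3
  have f6 := hN' 2 3
  have h00 : N 0 0 = 0 := by linarith [hs' 0 0]
  have h11 : N 1 1 = 0 := by linarith [hs' 1 1]
  have h22 : N 2 2 = 0 := by linarith [hs' 2 2]
  have h33 : N 3 3 = 0 := by linarith [hs' 3 3]
  simp [h00, h11, h22, h33, hs' 0 1, hs' 0 2, hs' 0 3, hs' 1 2, hs' 1 3, hs' 2 3] at e0 e1 e2 e3 f1 f2 f3 f4 f5 f6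
  unfold pfaffian at hp
  have hx : N 0 1 ^ 2 + N 0 2 ^ 2 + N 0 3 ^ 2 = 1 := by linarith
  have hy : N 2 3 ^ 2 + N 1 3 ^ 2 + N 1 2 ^ 2 = 1 := by linarith
  -- Lagrange's identity for the two triples of entries: the Pfaffian is their inner product up to
  -- signs, and the off-diagonal entries of N² = -1 make the cross product vanish.
  have hp2 : (N 0 1 * N 2 3 - N 0 2 * N 1 3 + N 0 3 * N 1 2) ^ 2 = 1 := by
    have h1 : N 0 1 * N 1 3 + N 0 2 * N 2 3 = 0 := by linarith
    have h2 : N 0 1 * N 1 2 - N 0 3 * N 2 3 = 0 := by linarith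
    have h3 : N 0 2 * N 1 2 + N 0 3 * N 1 3 = 0 := by linarith
    linear_combination hx + (N 0 1 ^ 2 + N 0 2 ^ 2 + N 0 3 ^ 2) * hy
      - (N 0 1 * N 1 3 + N 0 2 * N 2 3) * h1
      - (N 0 1 * N 1 2 - N 0 3 * N 2 3) * h2 - (N 0 2 * N 1 2 + N 0 3 * N 1 3) * h3
  have hp3 : N 0 1 * N 2 3 - N 0 2 * N 1 3 + N 0 3 * N 1 2 = -1 := by
    rcases (sq_eq_sq_iff_eq_or_eq_neg.mp (hp2.trans (one_pow 2).symm)) with h | h <;> linarith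
  have hz : (N 0 1 + N 2 3) ^ 2 + (N 0 2 - N 1 3) ^ 2 + (N 0 3 + N 1 2) ^ 2 = 0 := by
    linear_combination hx + hy + 2 * hp3
  obtain ⟨k1, k2, k3⟩ := eq_zero_of_sum_sq_eq_zero hz
  refine ⟨![-N 0 2, -N 0 1, N 0 3], ?_, ?_⟩
  · have g01 := hs' 0 1
    have g02 := hs' 0 2
    have g03 := hs' 0 3
    have g12 := hs' 1 2
    have g13 := hs' 1 3
    have g23 := hs' 2 3
    ext i j
    fin_cases i <;> fin_cases j <;> simp [quatMat, matT, matU, stdJ] <;> linarith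
  · simp
    linarith

theorem stdJ_transpose : stdJᵀ = -stdJ := by
  ext i j; fin_cases i <;> fin_cases j <;> simp [stdJ]

theorem stdJ_mul_stdJ : stdJ * stdJ = -1 := by
  ext i j; fin_cases i <;> fin_cases j <;> simp [stdJ, Matrix.mul_apply, Fin.sum_univ_four]

theorem exists_of_mem_QA {S : Matrix (Fin 4) (Fin 4) ℝ} (hS : S ∈ QA) :
    ∃ a b c d x y : ℝ, S = !![a, b, c, d; b, x, d, y; c, d, -a, -b; d, y, -b, -x] := by
  obtain ⟨A, B, hA, hB, rfl⟩ := hS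
  have hA' : A 1 0 = A 0 1 := congrFun (congrFun hA 0) 1
  have hB' : B 1 0 = B 0 1 := congrFun (congrFun hB 0) 1
  refine ⟨A 0 0, A 0 1, B 0 0, B 0 1, A 1 1, B 1 1, ?_⟩
  ext i j
  fin_cases i <;> fin_cases j <;> first | rfl | exact hA' | exact hB' | exact congrArg Neg.neg hA'

theorem QA_symm_anticomm {S : Matrix (Fin 4) (Fin 4) ℝ} (hS : S ∈ QA) :
    Sᵀ = S ∧ S * stdJ + stdJ * S = 0 := by
  obtain ⟨a, b, c, d, x, y, rfl⟩ := exists_of_mem_QA hS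
  constructor
  · ext i j; fin_cases i <;> fin_cases j <;> simp
  · ext i j
    fin_cases i <;> fin_cases j <;> simp [stdJ]

/-- Since T = JU and U = -JT, moving `S` past `J` turns anticommutators into commutators. This is
how `mapK`, built from commutators, meets anticommutation conditions. -/
theorem anticomm_matT_matU {S : Matrix (Fin 4) (Fin 4) ℝ} (h : S * stdJ + stdJ * S = 0) :
    S * matT + matT * S = -(stdJ * (S * matU - matU * S)) ∧
    S * matU + matU * S = stdJ * (S * matT - matT * S) := by
  have h1 : matT = stdJ * matU := by
    ext i j; fin_cases i <;> fin_cases j <;>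
      simp [stdJ, matT, matU, Matrix.mul_apply, Fin.sum_univ_four]
  have h2 : matU = -(stdJ * matT) := by
    ext i j; fin_cases i <;> fin_cases j <;>
      simp [stdJ, matT, matU]
  have h3 : S * stdJ = -(stdJ * S) := eq_neg_of_add_eq_zero_left h
  constructor
  · nth_rw 1 2 [h1]
    rw [← mul_assoc, h3]; noncomm_ring
  · nth_rw 1 2 [h2]
    rw [mul_neg, ← mul_assoc, h3]; noncomm_ring

/-- If bT + cU anticommutes with `S`, then c[S,T] = b[S,U]; applying this to the all-ones vector
gives a null vector of `mapK S`, the same for every such `S`. -/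
theorem mapK_mulVec_of_anticomm {S : Matrix (Fin 4) (Fin 4) ℝ} (hJ : S * stdJ + stdJ * S = 0)
    {b c : ℝ} (h0 : b • (S * matT + matT * S) + c • (S * matU + matU * S) = 0) :
    (mapK S).mulVec (Sum.elim (fun _ => c) (fun _ => -b)) = 0 := by
  rw [(anticomm_matT_matU hJ).1, (anticomm_matT_matU hJ).2] at h0
  have h1 : c • (S * matT - matT * S) - b • (S * matU - matU * S) = 0 := by
    have h2 := congrArg (fun X => -(stdJ * X)) h0
    simp only [mul_add, mul_neg, smul_neg, Matrix.mul_smul, ← mul_assoc, stdJ_mul_stdJ, mul_zero] at h2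
    rw [← neg_zero, ← h2]
    simp [sub_eq_add_neg, add_comm]
  have h4 : (c • (S * matT - matT * S) - b • (S * matU - matU * S)).mulVec (fun _ => (1:ℝ)) = 0 := by
    rw [h1]; simp
  rw [mapK, Matrix.fromCols_mulVec, ← h4, Matrix.sub_mulVec (c • _), Matrix.smul_mulVec, Matrix.smul_mulVec]
  have hc : (fun _ => c : Fin 4 → ℝ) = c • fun _ => 1 := by ext; simp
  have hb : (fun _ => -b : Fin 4 → ℝ) = -b • fun _ => 1 := by ext; simp
  simp only [Sum.elim_comp_inl, Sum.elim_comp_inr]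
  rw [hc, hb, Matrix.mulVec_smul, Matrix.mulVec_smul]
  simp [sub_eq_add_neg]

/-- The contraction of the Codazzi equation. -/
theorem mapK_mulVec_eq_zero {S : Matrix (Fin 4) (Fin 4) ℝ} (hS : S ∈ QA)
    (C : Fin 4 → Fin 4 → Fin 4 → ℝ) (h1 : ∀ i j k, C i j k = C j i k)
    (h2 : ∀ i j k, C i j k = C i k j) (t u : Fin 4 → ℝ)
    (h : ∀ i j k, ∑ l, stdJ l j * C i l k - ∑ l, stdJ l k * C i j l =
      -∑ l, (t i • matT + u i • matU) l j * S l k + ∑ l, (t i • matT + u i • matU) l k * S j l) :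
    (mapK S).mulVec (Sum.elim u (-t)) = 0 := by
  obtain ⟨a, b, c, d, x, y, rfl⟩ := exists_of_mem_QA hS
  -- Summing `key i i k` over `i` kills the first term, since `C` is symmetric and `J` skew, and
  -- leaves the trace of `C` in the direction J e_k. With J e_k = ±e_l, that trace is also given by
  -- `key l 0 2 + key l 1 3`, whose right side vanishes as a trace of symmetric times skew matrices.
  -- What remains is a combination of anticommutators of `S` with T and U, which `J` converts into
  -- row `l` of the claim.
  have key : ∀ i j k, _ := fun i j k => h i j k
  simp only [Fin.sum_univ_four] at key
  ext l
  obtain rfl | rfl | rfl | rfl : l = 0 ∨ l = 1 ∨ l = 2 ∨ l = 3 := by fin_cases l <;> simp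
  · have f0 := key 0 0 2
    have f1 := key 1 1 2
    have f2 := key 2 2 2
    have f3 := key 3 3 2
    have f4 := key 0 0 2
    have f5 := key 0 1 3
    simp [stdJ, matT, matU] at f0 f1 f2 f3 f4 f5
    simp [mapK, Matrix.mulVec, dotProduct, Fin.sum_univ_four, matT, matU]
    linarith [(h2 1 1 0).trans (h1 1 0 1), h2 1 3 2, h1 2 0 2, (h2 2 2 0).trans (h1 2 0 2),
      (h1 3 1 2).trans (h2 1 3 2), (h2 3 3 0).trans (h1 3 0 3)]
  · have f0 := key 0 0 3
    have f1 := key 1 1 3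
    have f2 := key 2 2 3
    have f3 := key 3 3 3
    have f4 := key 1 0 2
    have f5 := key 1 1 3
    simp [stdJ, matT, matU] at f0 f1 f2 f3 f4 f5
    simp [mapK, Matrix.mulVec, dotProduct, Fin.sum_univ_four, matT, matU]
    linarith [(h1 1 0 0).trans (h2 0 1 0), h1 2 0 3, (h2 2 2 1).trans (h1 2 1 2), h1 3 1 3,
      (h2 3 3 1).trans (h1 3 1 3)]
  · have f0 := key 0 0 0
    have f1 := key 1 1 0
    have f2 := key 2 2 0
    have f3 := key 3 3 0
    have f4 := key 2 0 2
    have f5 := key 2 1 3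
    simp [stdJ, matT, matU] at f0 f1 f2 f3 f4 f5
    simp [mapK, Matrix.mulVec, dotProduct, Fin.sum_univ_four, matT, matU]
    linarith [h2 0 2 0, (h2 1 3 0).trans (h1 1 0 3), (h1 2 0 0).trans (h2 0 2 0),
      (h1 2 1 1).trans (h2 1 2 1), ((h1 3 1 0).trans (h2 1 3 0)).trans (h1 1 0 3),
      (h2 3 3 2).trans (h1 3 2 3)]
  · have f0 := key 0 0 1
    have f1 := key 1 1 1
    have f2 := key 2 2 1
    have f3 := key 3 3 1
    have f4 := key 3 0 2
    have f5 := key 3 1 3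
    simp [stdJ, matT, matU] at f0 f1 f2 f3 f4 f5
    simp [mapK, Matrix.mulVec, dotProduct, Fin.sum_univ_four, matT, matU]
    linarith [h2 0 2 1, h2 1 3 1, (h1 2 0 1).trans (h2 0 2 1), (h1 3 0 0).trans (h2 0 3 0),
      (h1 3 1 1).trans (h2 1 3 1), (h1 3 2 2).trans (h2 2 3 2)]

/-! ### The pseudoinverse of an injective map and its smooth dependence on the map. -/

section LinearAlgebra

variable {E V : Type*} [NormedAddCommGroup E] [InnerProductSpace ℝ E] [FiniteDimensional ℝ E]
  [NormedAddCommGroup V] [InnerProductSpace ℝ V] [FiniteDimensional ℝ V]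

/-- The Moore–Penrose inverse of an injective linear map. -/
def pinv (A : E →L[ℝ] V) : V →L[ℝ] E :=
  (ContinuousLinearMap.adjoint A ∘L A).inverse ∘L ContinuousLinearMap.adjoint A

theorem isInvertible_adjoint_comp_self {A : E →L[ℝ] V} (hA : Function.Injective A) :
    (ContinuousLinearMap.adjoint A ∘L A).IsInvertible := by
  have hinj : Function.Injective (ContinuousLinearMap.adjoint A ∘L A).toLinearMap := by
    rw [← LinearMap.ker_eq_bot, LinearMap.ker_eq_bot']
    intro m hm
    have h1 : inner ℝ (A m) (A m) = 0 := by
      have : ContinuousLinearMap.adjoint A (A m) = 0 := hm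
      rw [← ContinuousLinearMap.adjoint_inner_left, this, inner_zero_left]
    exact hA (by rw [inner_self_eq_zero.mp h1, map_zero])
  exact ⟨(LinearEquiv.ofInjectiveEndo _ hinj).toContinuousLinearEquiv, rfl⟩

theorem pinv_apply_self {A : E →L[ℝ] V} (hA : Function.Injective A) (y : E) : pinv A (A y) = y :=
  (isInvertible_adjoint_comp_self hA).inverse_apply_self y

theorem inner_sub_pinv {A : E →L[ℝ] V} (hA : Function.Injective A) (w : V) (y : E) :
    inner ℝ (w - A (pinv A w)) (A y) = 0 := by
  rw [← ContinuousLinearMap.adjoint_inner_left, map_sub]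
  have h : ContinuousLinearMap.adjoint A (A (pinv A w)) = ContinuousLinearMap.adjoint A w :=
    (isInvertible_adjoint_comp_self hA).self_apply_inverse (ContinuousLinearMap.adjoint A w)
  rw [h, sub_self, inner_zero_left]

theorem starProjection_range {A : E →L[ℝ] V} (hA : Function.Injective A) (w : V) :
    (LinearMap.range A.toLinearMap).starProjection w = A (pinv A w) := by
  refine Submodule.eq_starProjection_of_mem_of_inner_eq_zero ⟨_, rfl⟩ ?_
  rintro _ ⟨y, rfl⟩
  exact inner_sub_pinv hA w y

/-- Inversion is smooth at the invertible operator A*A. Writing tangential projections through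
`pinv` makes them smooth functions of dF. -/
theorem contDiffAt_pinv {n : WithTop ℕ∞} {A : E →L[ℝ] V} (hA : Function.Injective A) :
    ContDiffAt ℝ n (pinv : (E →L[ℝ] V) → V →L[ℝ] E) A := by
  have had : ContDiff ℝ n (fun A : E →L[ℝ] V => ContinuousLinearMap.adjoint A) :=
    (ContinuousLinearMap.adjoint (𝕜 := ℝ) (E := E) (F := V)).contDiff
  have h2 : ContDiffAt ℝ n (fun A : E →L[ℝ] V => ContinuousLinearMap.adjoint A ∘L A) A :=
    had.contDiffAt.clm_comp contDiffAt_id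
  have h3 : ContDiffAt ℝ n ContinuousLinearMap.inverse
      ((fun A : E →L[ℝ] V => ContinuousLinearMap.adjoint A ∘L A) A) :=
    (isInvertible_adjoint_comp_self hA).contDiffAt_map_inverse
  exact (ContDiffAt.comp (f := fun A : E →L[ℝ] V => ContinuousLinearMap.adjoint A ∘L A) A h3
    h2).clm_comp had.contDiffAt

end LinearAlgebra

/-! ### Covariant derivatives and the Codazzi equation for an immersion in coordinates. -/

variable {E V : Type*} [NormedAddCommGroup E] [InnerProductSpace ℝ E] [FiniteDimensional ℝ E]
  [NormedAddCommGroup V] [InnerProductSpace ℝ V] [FiniteDimensional ℝ V]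

/-- The Christoffel symbols of the metric induced by `F`. -/
def christoffel (F : E → V) (x : E) (u y : E) : E := pinv (fderiv ℝ F x) (fderiv ℝ (fderiv ℝ F) x u y)

/-- The covariant derivative of a field of endomorphisms in coordinates. -/
def covDerivEnd (F : E → V) (J : E → E →L[ℝ] E) (x : E) (u y : E) : E :=
  fderiv ℝ J x u y + christoffel F x u (J x y) - J x (christoffel F x u y)

section

variable {E G : Type*} [NormedAddCommGroup E] [NormedSpace ℝ E] [NormedAddCommGroup G]
  [NormedSpace ℝ G] {f : E → G} {x : E}

theorem contDiffAt_fderiv (hf : ContDiffAt ℝ ∞ f x) : ContDiffAt ℝ ∞ (fderiv ℝ f) x :=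
  hf.fderiv_right (by norm_cast)

theorem differentiableAt_of_contDiffAt_infty (hf : ContDiffAt ℝ ∞ f x) : DifferentiableAt ℝ f x :=
  hf.differentiableAt (by simp)

theorem fderiv_fderiv_symm (hf : ContDiffAt ℝ ∞ f x) (u y : E) :
    fderiv ℝ (fderiv ℝ f) x u y = fderiv ℝ (fderiv ℝ f) x y u :=
  hf.isSymmSndFDerivAt (by simpa using (by norm_cast : (2 : WithTop ℕ∞) ≤ ∞)) u y

end

section Local

variable {F : E → V} {J : E → E →L[ℝ] E} {x₀ : E}

/-- Differentiate J² = -1; the Christoffel terms cancel. -/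
theorem covDerivEnd_anticomm (hJ : DifferentiableAt ℝ J x₀)
    (hsq : ∀ᶠ x in 𝓝 x₀, ∀ y, J x (J x y) = -y) (u y : E) :
    covDerivEnd F J x₀ u (J x₀ y) + J x₀ (covDerivEnd F J x₀ u y) = 0 := by
  have h0 := hsq.self_of_nhds
  have h1 : HasFDerivAt (fun x => J x (J x y)) _ x₀ :=
    hJ.hasFDerivAt.clm_apply (hJ.hasFDerivAt.clm_apply (hasFDerivAt_const y x₀))
  have h2 : HasFDerivAt (fun x => J x (J x y)) (0 : E →L[ℝ] E) x₀ :=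
    (hasFDerivAt_const (-y) x₀).congr_of_eventuallyEq (hsq.mono fun x hx => hx y)
  have h3 := congrArg (fun L => L u) (h1.unique h2)
  simp at h3
  simp only [covDerivEnd, h0, map_add, map_sub, christoffel, map_neg]
  rw [← h3]
  abel

theorem inner_apply_christoffel (hinj : Function.Injective (fderiv ℝ F x₀)) (u y z : E) :
    inner ℝ (fderiv ℝ F x₀ (christoffel F x₀ u y)) (fderiv ℝ F x₀ z) =
      inner ℝ (fderiv ℝ (fderiv ℝ F) x₀ u y) (fderiv ℝ F x₀ z) := by
  have := inner_sub_pinv hinj (fderiv ℝ (fderiv ℝ F) x₀ u y) z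
  rw [inner_sub_left, sub_eq_zero] at this
  exact this.symm

/-- Differentiate the skewness of `J`; the second derivatives of `F` that appear are absorbed by the
Christoffel terms, which is metric compatibility. -/
theorem covDerivEnd_skew (hF : ContDiffAt ℝ ∞ F x₀) (hinj : Function.Injective (fderiv ℝ F x₀))
    (hJ : DifferentiableAt ℝ J x₀)
    (hsk : ∀ᶠ x in 𝓝 x₀, ∀ y z, inner ℝ (fderiv ℝ F x (J x y)) (fderiv ℝ F x z) =
      -inner ℝ (fderiv ℝ F x y) (fderiv ℝ F x (J x z))) (u y z : E) :
    inner ℝ (fderiv ℝ F x₀ (covDerivEnd F J x₀ u y)) (fderiv ℝ F x₀ z) =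
      -inner ℝ (fderiv ℝ F x₀ y) (fderiv ℝ F x₀ (covDerivEnd F J x₀ u z)) := by
  have h0 := hsk.self_of_nhds
  have hD : HasFDerivAt (fderiv ℝ F) _ x₀ :=
    ((hF.fderiv_right (m := 1) (by norm_cast)).differentiableAt one_ne_zero).hasFDerivAt
  have hJD : ∀ y, HasFDerivAt (fun x => fderiv ℝ F x (J x y)) _ x₀ := fun y =>
    hD.clm_apply (hJ.hasFDerivAt.clm_apply (hasFDerivAt_const y x₀))
  have hcD : ∀ y, HasFDerivAt (fun x => fderiv ℝ F x y) _ x₀ := fun y =>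
    hD.clm_apply (hasFDerivAt_const y x₀)
  have h1 := (hJD y).inner ℝ (hcD z)
  have h2 := ((hcD y).inner ℝ (hJD z)).neg
  have h3 := congrArg (fun L => L u) (h1.unique (h2.congr_of_eventuallyEq (hsk.mono fun x hx => hx y z)))
  simp [inner_add_left, inner_add_right] at h3
  have c1 := inner_apply_christoffel hinj u (J x₀ y) z
  have c2 := inner_apply_christoffel hinj u (J x₀ z) y
  have c3 := inner_apply_christoffel hinj u y (J x₀ z)
  have c4 := inner_apply_christoffel hinj u z (J x₀ y)
  have c5 := h0 (christoffel F x₀ u y) z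
  have c6 := h0 y (christoffel F x₀ u z)
  simp only [covDerivEnd, map_add, map_sub, inner_add_left, inner_sub_left, inner_add_right, inner_sub_right]
  rw [real_inner_comm] at c2 c4
  rw [real_inner_comm _ (fderiv ℝ (fderiv ℝ F) x₀ u (J x₀ z))] at c2
  rw [real_inner_comm _ (fderiv ℝ (fderiv ℝ F) x₀ u z)] at c4
  linarith

/-- The covariant derivative of the second fundamental form in the normal direction `ν`. -/
def codazziForm (F : E → V) (x : E) (ν : V) (u y z : E) : ℝ :=
  inner ℝ ν (fderiv ℝ (fderiv ℝ (fderiv ℝ F)) x u y z)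
    - inner ℝ ν (fderiv ℝ (fderiv ℝ F) x u (christoffel F x y z))
    - inner ℝ ν (fderiv ℝ (fderiv ℝ F) x y (christoffel F x u z))
    - inner ℝ ν (fderiv ℝ (fderiv ℝ F) x z (christoffel F x u y))

theorem christoffel_symm (hF : ContDiffAt ℝ ∞ F x₀) (u y : E) :
    christoffel F x₀ u y = christoffel F x₀ y u := by
  rw [christoffel, christoffel, fderiv_fderiv_symm hF]

/-- Codazzi in flat space reduces to symmetry of the derivatives of `F`. The term with Γ(y, z) comes
from differentiating the tangential part of the second derivative, and it makes the expression
symmetric in all three arguments. -/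
theorem codazziForm_swap_left (hF : ContDiffAt ℝ ∞ F x₀) (ν : V) (u y z : E) :
    codazziForm F x₀ ν u y z = codazziForm F x₀ ν y u z := by
  have h : fderiv ℝ (fderiv ℝ (fderiv ℝ F)) x₀ u y = fderiv ℝ (fderiv ℝ (fderiv ℝ F)) x₀ y u :=
    fderiv_fderiv_symm (contDiffAt_fderiv hF) u y
  rw [codazziForm, codazziForm, h, christoffel_symm hF u y]
  ring

theorem codazziForm_swap_right (hF : ContDiffAt ℝ ∞ F x₀) (ν : V) (u y z : E) :
    codazziForm F x₀ ν u y z = codazziForm F x₀ ν u z y := by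
  have hD := (differentiableAt_of_contDiffAt_infty
    (contDiffAt_fderiv (contDiffAt_fderiv hF))).hasFDerivAt
  have h1 : ∀ y z, HasFDerivAt (fun x => fderiv ℝ (fderiv ℝ F) x y z) _ x₀ := fun y z =>
    (hD.clm_apply (hasFDerivAt_const y x₀)).clm_apply (hasFDerivAt_const z x₀)
  have h2 : (fun x => fderiv ℝ (fderiv ℝ F) x y z) =ᶠ[𝓝 x₀] fun x => fderiv ℝ (fderiv ℝ F) x z y := by
    have hF2 : ContDiffAt ℝ 2 F x₀ := hF.of_le (by norm_cast)
    filter_upwards [hF2.eventually (by simp)] with x hx using hx.isSymmSndFDerivAt (by simp) y z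
  have h3 := congrArg (fun L => L u) ((h1 y z).unique ((h1 z y).congr_of_eventuallyEq h2))
  simp at h3
  rw [codazziForm, codazziForm, h3, christoffel_symm hF y z]
  ring

/-- This is the derivative along `u` of II(Jy, z) = II(y, Jz), tested against a normal vector at the
point. -/
theorem codazzi_covDerivEnd (hF : ContDiffAt ℝ ∞ F x₀)
    (hinj : Function.Injective (fderiv ℝ F x₀)) (hJ : DifferentiableAt ℝ J x₀)
    (hII : ∀ᶠ x in 𝓝 x₀, Function.Injective (fderiv ℝ F x) ∧ ∀ y z, ∃ a,
      fderiv ℝ (fderiv ℝ F) x (J x y) z - fderiv ℝ (fderiv ℝ F) x y (J x z) = fderiv ℝ F x a)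
    {ν : V} (hν : ∀ a, inner ℝ ν (fderiv ℝ F x₀ a) = 0) (u y z : E) :
    codazziForm F x₀ ν u (J x₀ y) z - codazziForm F x₀ ν u y (J x₀ z) =
      -inner ℝ ν (fderiv ℝ (fderiv ℝ F) x₀ (covDerivEnd F J x₀ u y) z) +
        inner ℝ ν (fderiv ℝ (fderiv ℝ F) x₀ y (covDerivEnd F J x₀ u z)) := by
  have hD1 := differentiableAt_of_contDiffAt_infty (contDiffAt_fderiv hF)
  have hD2 := differentiableAt_of_contDiffAt_infty (contDiffAt_fderiv (contDiffAt_fderiv hF))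
  have hP : DifferentiableAt ℝ (fun x => pinv (fderiv ℝ F x)) x₀ :=
    ((contDiffAt_pinv (n := ∞) hinj).differentiableAt (by simp)).comp x₀ hD1
  have hJy : ∀ y, HasFDerivAt (fun x => J x y) _ x₀ := fun y =>
    hJ.hasFDerivAt.clm_apply (hasFDerivAt_const y x₀)
  set G : E → V := fun x =>
    fderiv ℝ (fderiv ℝ F) x (J x y) z - fderiv ℝ (fderiv ℝ F) x y (J x z) with hGdef
  have hG : HasFDerivAt G _ x₀ :=
    ((hD2.hasFDerivAt.clm_apply (hJy y)).clm_apply (hasFDerivAt_const z x₀)).sub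
      ((hD2.hasFDerivAt.clm_apply (hasFDerivAt_const y x₀)).clm_apply (hJy z))
  have hGP : DifferentiableAt ℝ (fun x => pinv (fderiv ℝ F x) (G x)) x₀ :=
    hP.clm_apply hG.differentiableAt
  have hR : HasFDerivAt (fun x => fderiv ℝ F x (pinv (fderiv ℝ F x) (G x))) _ x₀ :=
    hD1.hasFDerivAt.clm_apply hGP.hasFDerivAt
  -- `G` is tangential near the point, so it equals dF applied to its pseudoinverse image.
  -- Differentiating that form, only the second derivative of `F` survives against `ν`; hence `ν`
  -- need not be extended to a normal field.
  have hGR : G =ᶠ[𝓝 x₀] fun x => fderiv ℝ F x (pinv (fderiv ℝ F x) (G x)) := by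
    filter_upwards [hII] with x hx
    obtain ⟨a, ha⟩ := hx.2 y z
    simp only [hGdef]
    rw [ha, pinv_apply_self hx.1]
  have h3 := congrArg (fun L => inner ℝ ν (L u)) (hG.unique (hR.congr_of_eventuallyEq hGR))
  have h4 : pinv (fderiv ℝ F x₀) (G x₀) =
      christoffel F x₀ (J x₀ y) z - christoffel F x₀ y (J x₀ z) := by
    simp only [hGdef, christoffel, map_sub]
  simp [h4, inner_add_right, inner_sub_right, hν] at h3
  have hh : ∀ a b, inner ℝ ν (fderiv ℝ (fderiv ℝ F) x₀ (J x₀ a) b) =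
      inner ℝ ν (fderiv ℝ (fderiv ℝ F) x₀ a (J x₀ b)) := fun a b => by
    obtain ⟨c, hc⟩ := hII.self_of_nhds.2 a b
    rw [← sub_eq_zero, ← inner_sub_right, hc, hν]
  have e1 := hh y (christoffel F x₀ u z)
  have e2 := hh (christoffel F x₀ u y) z
  rw [fderiv_fderiv_symm hF _ (J x₀ z)] at e2
  have e3 := fderiv_fderiv_symm hF (christoffel F x₀ u (J x₀ y)) z
  simp only [codazziForm, covDerivEnd, map_add, map_sub, inner_add_right, inner_sub_right,
    add_apply, sub_apply, e3]
  linarith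

theorem frame_expansion {D : E →L[ℝ] V} {b : Fin 4 → E} (hE : Module.finrank ℝ E = 4)
    (hb : Orthonormal ℝ fun i => D (b i)) (v : E) : ∑ i, inner ℝ (D (b i)) (D v) • b i = v := by
  have hli : LinearIndependent ℝ b := LinearIndependent.of_comp D.toLinearMap hb.linearIndependent
  have hv : v ∈ Submodule.span ℝ (Set.range b) := by
    rw [hli.span_eq_top_of_card_eq_finrank' (by simp [hE])]
    trivial
  obtain ⟨c, rfl⟩ := (Submodule.mem_span_range_iff_exists_fun ℝ).mp hv
  refine Finset.sum_congr rfl fun i _ => ?_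
  congr 1
  rw [map_sum, inner_sum]
  simp only [map_smul, inner_smul_right, orthonormal_iff_ite.mp hb]
  simp

/-- The matrix of the second fundamental form in the direction `ν`, in coordinates. -/
def secondMatrix (F : E → V) (x : E) (b : Fin 4 → E) (ν : V) : Matrix (Fin 4) (Fin 4) ℝ :=
  Matrix.of fun i j => inner ℝ ν (fderiv ℝ (fderiv ℝ F) x (b i) (b j))

/-- The factor `s` lets the same argument serve `J` and `-J`. -/
theorem covDerivEnd_eq_zero (hE : Module.finrank ℝ E = 4) (hF : ContDiffAt ℝ ∞ F x₀)
    (hJ : DifferentiableAt ℝ J x₀)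
    (hsq : ∀ᶠ x in 𝓝 x₀, ∀ y, J x (J x y) = -y)
    (hsk : ∀ᶠ x in 𝓝 x₀, ∀ y z, inner ℝ (fderiv ℝ F x (J x y)) (fderiv ℝ F x z) =
      -inner ℝ (fderiv ℝ F x y) (fderiv ℝ F x (J x z)))
    (hII : ∀ᶠ x in 𝓝 x₀, Function.Injective (fderiv ℝ F x) ∧ ∀ y z, ∃ a,
      fderiv ℝ (fderiv ℝ F) x (J x y) z - fderiv ℝ (fderiv ℝ F) x y (J x z) = fderiv ℝ F x a)
    {b : Fin 4 → E} (hb : Orthonormal ℝ fun i => fderiv ℝ F x₀ (b i)) {s : ℝ} (hs : s ≠ 0)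
    (hJb : ∀ j, J x₀ (b j) = s • ∑ i, stdJ i j • b i)
    (hQ : ∀ ν, (∀ a, inner ℝ ν (fderiv ℝ F x₀ a) = 0) → secondMatrix F x₀ b ν ∈ QA)
    (hK : ∀ w, (∀ ν, (∀ a, inner ℝ ν (fderiv ℝ F x₀ a) = 0) →
      (mapK (secondMatrix F x₀ b ν)).mulVec w = 0) → w = 0) (u y : E) :
    covDerivEnd F J x₀ u y = 0 := by
  have hinj := hII.self_of_nhds.1
  have hexp := frame_expansion hE hb
  set N : Fin 4 → Matrix (Fin 4) (Fin 4) ℝ := fun k => Matrix.of fun i j =>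
    inner ℝ (fderiv ℝ F x₀ (b i)) (fderiv ℝ F x₀ (covDerivEnd F J x₀ (b k) (b j))) with hN
  have hΘ : ∀ k j, covDerivEnd F J x₀ (b k) (b j) = ∑ i, N k i j • b i := fun k j =>
    (hexp _).symm
  have hskew : ∀ k, (N k)ᵀ = -N k := fun k => by
    ext i j
    simp only [hN, Matrix.transpose_apply, Matrix.of_apply, Matrix.neg_apply]
    rw [← covDerivEnd_skew hF hinj hJ hsk, real_inner_comm]
  have hlin : ∀ k (c : Fin 4 → ℝ), covDerivEnd F J x₀ (b k) (∑ i, c i • b i) =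
      ∑ i, c i • covDerivEnd F J x₀ (b k) (b i) := fun k c => by
    simp only [covDerivEnd, christoffel, map_sum, map_smul, smul_add, smul_sub,
      Finset.sum_add_distrib, Finset.sum_sub_distrib]
  have hanti : ∀ k, N k * stdJ + stdJ * N k = 0 := fun k => by
    ext i j
    have h1 := congrArg (fun v => inner ℝ (fderiv ℝ F x₀ (b i)) (fderiv ℝ F x₀ v))
      (covDerivEnd_anticomm (F := F) hJ hsq (b k) (b j))
    rw [hJb, hΘ k j, Finset.smul_sum] at h1
    simp only [smul_smul, hlin, map_add, map_sum, map_smul, hJb, inner_add_right, inner_sum,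
      inner_smul_right, map_zero, inner_zero_right, orthonormal_iff_ite.mp hb] at h1
    simp only [mul_ite, mul_one, mul_zero, Finset.sum_ite_eq, Finset.mem_univ, if_true] at h1
    refine mul_left_cancel₀ hs ?_
    rw [Matrix.add_apply, Matrix.mul_apply, Matrix.mul_apply, Matrix.zero_apply, mul_zero, ← h1,
      mul_add, Finset.mul_sum, Finset.mul_sum]
    congr 1 <;> refine Finset.sum_congr rfl fun l _ => ?_
    · simp only [hN, Matrix.of_apply]; ring
    · ring
  choose t r htr using fun k => exists_eq_add_of_skew_of_anticomm (hskew k) (hanti k)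
  have hw : Sum.elim r (-t) = 0 := by
    refine hK _ fun ν hν => ?_
    -- In the frame, J x₀ has matrix s times `stdJ`, so `s` is moved into the symmetric tensor.
    refine mapK_mulVec_eq_zero (hQ ν hν) (fun i j k => s * codazziForm F x₀ ν (b i) (b j) (b k))
      (fun i j k => by rw [codazziForm_swap_left hF ν (b i)])
      (fun i j k => by rw [codazziForm_swap_right hF ν (b i)])
      t r fun i j k => ?_
    have hC : ∀ (c : Fin 4 → ℝ) z, codazziForm F x₀ ν (b i) (∑ l, c l • b l) z =
        ∑ l, c l * codazziForm F x₀ ν (b i) (b l) z := fun c z => by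
      simp only [codazziForm, christoffel, map_sum, map_smul, inner_sum, inner_smul_right,
        sum_apply, smul_apply, mul_sub, Finset.sum_sub_distrib]
    have hC' : ∀ (c : Fin 4 → ℝ) z, codazziForm F x₀ ν (b i) z (∑ l, c l • b l) =
        ∑ l, c l * codazziForm F x₀ ν (b i) z (b l) := fun c z => by
      rw [codazziForm_swap_right hF, hC]
      exact Finset.sum_congr rfl fun l _ => by rw [codazziForm_swap_right hF]
    have h1 := codazzi_covDerivEnd hF hinj hJ hII hν (b i) (b j) (b k)
    rw [hJb, hJb, Finset.smul_sum, Finset.smul_sum, hΘ, hΘ, htr] at h1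
    simp only [smul_smul, hC, hC', map_sum, map_smul, inner_sum, inner_smul_right, sum_apply,
      smul_apply] at h1
    simp only [secondMatrix, Matrix.of_apply]
    rw [← h1]
    congr 1 <;> exact Finset.sum_congr rfl fun l _ => by ring
  have hN0 : ∀ k, N k = 0 := fun k => by
    have h1 : r k = 0 := congrFun hw (Sum.inl k)
    have h2 : t k = 0 := by simpa using congrFun hw (Sum.inr k)
    rw [htr, h1, h2]; simp
  have h0 : ∀ k j, covDerivEnd F J x₀ (b k) (b j) = 0 := fun k j => by rw [hΘ, hN0]; simp
  have hlin' : ∀ (c : Fin 4 → ℝ) v, covDerivEnd F J x₀ (∑ i, c i • b i) v =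
      ∑ i, c i • covDerivEnd F J x₀ (b i) v := fun c v => by
    simp only [covDerivEnd, christoffel, map_sum, map_smul, smul_add, smul_sub,
      Finset.sum_add_distrib, Finset.sum_sub_distrib, sum_apply, smul_apply]
  rw [← hexp u, ← hexp y, hlin']
  simp [hlin, h0]

end Local

/-! ### Smooth orthonormal frames by Gram–Schmidt. -/

section SmoothFrame

variable {E V : Type*} [NormedAddCommGroup E] [InnerProductSpace ℝ E] [FiniteDimensional ℝ E]
  [NormedAddCommGroup V] [InnerProductSpace ℝ V] [FiniteDimensional ℝ V]

theorem contDiffAt_gramSchmidt {E V : Type*} [NormedAddCommGroup E] [NormedSpace ℝ E]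
    [NormedAddCommGroup V] [InnerProductSpace ℝ V] {k : ℕ} {n : WithTop ℕ∞} {v : E → Fin k → V}
    {x : E} (hv : ∀ i, ContDiffAt ℝ n (fun x => v x i) x) (hli : LinearIndependent ℝ (v x))
    (i : Fin k) : ContDiffAt ℝ n (fun x => InnerProductSpace.gramSchmidt ℝ (v x) i) x := by
  induction i using WellFoundedLT.induction with
  | ind i ih =>
    simp only [InnerProductSpace.gramSchmidt_def ℝ (v _) i, Submodule.starProjection_singleton]
    refine (hv i).sub (ContDiffAt.sum fun j hj => ?_)
    have hj' := ih j (Finset.mem_Iio.mp hj)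
    have hne := InnerProductSpace.gramSchmidt_ne_zero j hli
    refine ((hj'.inner ℝ (hv i)).div ((hj'.norm ℝ hne).pow 2) ?_).smul hj'
    exact pow_ne_zero 2 (norm_ne_zero_iff.mpr hne)

/-- The frame obtained from `b` by the Gram–Schmidt process for the metric induced by `F`. -/
def smoothFrame (F : E → V) (b : Fin 4 → E) (x : E) (i : Fin 4) : E :=
  pinv (fderiv ℝ F x) (InnerProductSpace.gramSchmidtNormed ℝ (fun j => fderiv ℝ F x (b j)) i)

variable {F : E → V} {b : Fin 4 → E} {x : E}

theorem linearIndependent_fderiv (hb : LinearIndependent ℝ b)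
    (hinj : Function.Injective (fderiv ℝ F x)) :
    LinearIndependent ℝ fun j => fderiv ℝ F x (b j) :=
  hb.map' (fderiv ℝ F x).toLinearMap (LinearMap.ker_eq_bot.mpr hinj)

theorem fderiv_smoothFrame (hinj : Function.Injective (fderiv ℝ F x)) (i : Fin 4) :
    fderiv ℝ F x (smoothFrame F b x i) =
      InnerProductSpace.gramSchmidtNormed ℝ (fun j => fderiv ℝ F x (b j)) i := by
  have h : InnerProductSpace.gramSchmidtNormed ℝ (fun j => fderiv ℝ F x (b j)) i ∈
      LinearMap.range (fderiv ℝ F x).toLinearMap := by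
    have h1 : InnerProductSpace.gramSchmidtNormed ℝ (fun j => fderiv ℝ F x (b j)) i ∈
        Submodule.span ℝ (Set.range fun j => fderiv ℝ F x (b j)) := by
      rw [← InnerProductSpace.span_gramSchmidt, ← InnerProductSpace.span_gramSchmidtNormed_range]
      exact Submodule.subset_span ⟨i, rfl⟩
    refine (Submodule.span_le.mpr ?_) h1
    rintro _ ⟨j, rfl⟩
    exact ⟨b j, rfl⟩
  obtain ⟨y, hy⟩ := h
  rw [smoothFrame, ← hy]
  exact congrArg _ (pinv_apply_self hinj y)

theorem orthonormal_smoothFrame (hb : LinearIndependent ℝ b)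
    (hinj : Function.Injective (fderiv ℝ F x)) :
    Orthonormal ℝ fun i => fderiv ℝ F x (smoothFrame F b x i) := by
  simp only [fderiv_smoothFrame hinj]
  exact InnerProductSpace.gramSchmidtNormed_orthonormal (linearIndependent_fderiv hb hinj)

theorem contDiffAt_smoothFrame (hb : LinearIndependent ℝ b) (hF : ContDiffAt ℝ ∞ F x)
    (hinj : Function.Injective (fderiv ℝ F x)) (i : Fin 4) :
    ContDiffAt ℝ ∞ (fun x => smoothFrame F b x i) x := by
  have hD := contDiffAt_fderiv hF
  have hli := linearIndependent_fderiv hb hinj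
  have hg := contDiffAt_gramSchmidt (v := fun x j => fderiv ℝ F x (b j))
    (fun j => hD.clm_apply contDiffAt_const) hli i
  have hne := InnerProductSpace.gramSchmidt_ne_zero i hli
  exact (ContDiffAt.comp x (contDiffAt_pinv hinj) hD).clm_apply
    (((hg.norm ℝ hne).inv (norm_ne_zero_iff.mpr hne)).smul hg)

/-- Gram–Schmidt fixes an orthonormal frame, so the smooth frame extends the given one and the
pointwise hypotheses on `Q_A` and `mapK` can be read in it at the base point. -/
theorem smoothFrame_of_orthonormal (hinj : Function.Injective (fderiv ℝ F x))
    (hb : Orthonormal ℝ fun i => fderiv ℝ F x (b i)) : smoothFrame F b x = b := by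
  ext1 i
  apply hinj
  rw [fderiv_smoothFrame hinj, InnerProductSpace.gramSchmidtNormed,
    InnerProductSpace.gramSchmidt_of_orthogonal ℝ (fun i j hij => hb.2 hij), hb.1 i]
  simp

end SmoothFrame

/-! ### Complex structures compatible with the second fundamental form. -/

section Adapted

variable {E V : Type*} [NormedAddCommGroup E] [InnerProductSpace ℝ E] [FiniteDimensional ℝ E]
  [NormedAddCommGroup V] [InnerProductSpace ℝ V] [FiniteDimensional ℝ V]

/-- An orthogonal complex structure that anticommutes with the second fundamental form, in
coordinates. -/
structure IsAdapted (F : E → V) (x : E) (L : E →L[ℝ] E) : Prop where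
  sq_eq : ∀ y, L (L y) = -y
  skew : ∀ y z, inner ℝ (fderiv ℝ F x (L y)) (fderiv ℝ F x z) =
    -inner ℝ (fderiv ℝ F x y) (fderiv ℝ F x (L z))
  second : ∀ ν, (∀ a, inner ℝ ν (fderiv ℝ F x a) = 0) → ∀ y z,
    inner ℝ ν (fderiv ℝ (fderiv ℝ F) x (L y) z) = inner ℝ ν (fderiv ℝ (fderiv ℝ F) x y (L z))

/-- The matrix of an endomorphism in an orthonormal frame. -/
def frameMatrix (F : E → V) (x : E) (X : Fin 4 → E) (L : E →L[ℝ] E) : Matrix (Fin 4) (Fin 4) ℝ :=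
  Matrix.of fun i j => inner ℝ (fderiv ℝ F x (X i)) (fderiv ℝ F x (L (X j)))

/-- The endomorphism with a given matrix in an orthonormal frame. -/
def ofFrameMatrix (F : E → V) (x : E) (X : Fin 4 → E) (m : Matrix (Fin 4) (Fin 4) ℝ) : E →L[ℝ] E :=
  ∑ j, ((innerSL ℝ (fderiv ℝ F x (X j))).comp (fderiv ℝ F x)).smulRight (∑ i, m i j • X i)

variable {F : E → V} {x : E} {L : E →L[ℝ] E} {X : Fin 4 → E}

theorem ofFrameMatrix_apply (m : Matrix (Fin 4) (Fin 4) ℝ) (v : E) :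
    ofFrameMatrix F x X m v =
      ∑ j, inner ℝ (fderiv ℝ F x (X j)) (fderiv ℝ F x v) • ∑ i, m i j • X i := by
  simp [ofFrameMatrix, sum_apply]

theorem ofFrameMatrix_frame (hX : Orthonormal ℝ fun i => fderiv ℝ F x (X i))
    (m : Matrix (Fin 4) (Fin 4) ℝ) (k : Fin 4) : ofFrameMatrix F x X m (X k) = ∑ i, m i k • X i := by
  rw [ofFrameMatrix_apply]
  simp only [orthonormal_iff_ite.mp hX, ite_smul, one_smul, zero_smul]
  simp

theorem apply_frame (hE : Module.finrank ℝ E = 4) (hX : Orthonormal ℝ fun i => fderiv ℝ F x (X i))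
    (L : E →L[ℝ] E) (j : Fin 4) : L (X j) = ∑ i, frameMatrix F x X L i j • X i :=
  (frame_expansion hE hX (L (X j))).symm

theorem ext_frame (hE : Module.finrank ℝ E = 4) (hX : Orthonormal ℝ fun i => fderiv ℝ F x (X i))
    {L L' : E →L[ℝ] E} (h : ∀ j, L (X j) = L' (X j)) : L = L' := by
  ext1 v
  rw [← frame_expansion hE hX v]
  simp [h]

theorem ofFrameMatrix_frameMatrix (hE : Module.finrank ℝ E = 4)
    (hX : Orthonormal ℝ fun i => fderiv ℝ F x (X i)) (L : E →L[ℝ] E) :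
    ofFrameMatrix F x X (frameMatrix F x X L) = L :=
  ext_frame hE hX fun j => by rw [ofFrameMatrix_frame hX, ← apply_frame hE hX]

theorem inner_fderiv_sum (hX : Orthonormal ℝ fun i => fderiv ℝ F x (X i)) (i : Fin 4)
    (c : Fin 4 → ℝ) : inner ℝ (fderiv ℝ F x (X i)) (fderiv ℝ F x (∑ k, c k • X k)) = c i := by
  simp only [map_sum, map_smul, inner_sum, inner_smul_right, orthonormal_iff_ite.mp hX]
  simp

theorem frameMatrix_ofFrameMatrix (hX : Orthonormal ℝ fun i => fderiv ℝ F x (X i))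
    (m : Matrix (Fin 4) (Fin 4) ℝ) : frameMatrix F x X (ofFrameMatrix F x X m) = m := by
  ext i j
  rw [frameMatrix, Matrix.of_apply, ofFrameMatrix_frame hX, inner_fderiv_sum hX]

theorem IsAdapted.transpose_frameMatrix (hL : IsAdapted F x L) :
    (frameMatrix F x X L)ᵀ = -frameMatrix F x X L := by
  ext i j
  simp only [frameMatrix, Matrix.transpose_apply, Matrix.neg_apply, Matrix.of_apply]
  rw [← hL.skew, real_inner_comm]

theorem IsAdapted.frameMatrix_mul_self (hE : Module.finrank ℝ E = 4)
    (hX : Orthonormal ℝ fun i => fderiv ℝ F x (X i)) (hL : IsAdapted F x L) :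
    frameMatrix F x X L * frameMatrix F x X L = -1 := by
  ext i j
  have h := congrArg (fun v => inner ℝ (fderiv ℝ F x (X i)) (fderiv ℝ F x v)) (hL.sq_eq (X j))
  rw [apply_frame hE hX L j] at h
  simp only [map_sum, map_smul, map_neg, inner_neg_right, inner_sum, inner_smul_right,
    orthonormal_iff_ite.mp hX] at h
  rw [Matrix.mul_apply, Matrix.neg_apply, Matrix.one_apply, ← h]
  exact Finset.sum_congr rfl fun k _ => by simp only [frameMatrix, Matrix.of_apply]; ring

theorem IsAdapted.secondMatrix_anticomm (hE : Module.finrank ℝ E = 4)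
    (hX : Orthonormal ℝ fun i => fderiv ℝ F x (X i)) (hL : IsAdapted F x L)
    {ν : V} (hν : ∀ a, inner ℝ ν (fderiv ℝ F x a) = 0) :
    secondMatrix F x X ν * frameMatrix F x X L + frameMatrix F x X L * secondMatrix F x X ν = 0 := by
  have h : (frameMatrix F x X L)ᵀ * secondMatrix F x X ν =
      secondMatrix F x X ν * frameMatrix F x X L := by
    ext i j
    have h1 := hL.second ν hν (X i) (X j)
    rw [apply_frame hE hX L i, apply_frame hE hX L j] at h1
    simp only [map_sum, map_smul, sum_apply, smul_apply, inner_sum, inner_smul_right] at h1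
    simp only [Matrix.mul_apply, Matrix.transpose_apply, secondMatrix, Matrix.of_apply]
    rw [h1]
    exact Finset.sum_congr rfl fun k _ => by ring
  rw [← h, hL.transpose_frameMatrix, neg_mul, neg_add_cancel]

/-- A frame in which the second fundamental form lies in `Q_A` makes `J` adapted. -/
theorem isAdapted_ofFrameMatrix_stdJ (hE : Module.finrank ℝ E = 4)
    (hX : Orthonormal ℝ fun i => fderiv ℝ F x (X i))
    (hQ : ∀ ν, (∀ a, inner ℝ ν (fderiv ℝ F x a) = 0) → secondMatrix F x X ν ∈ QA) :
    IsAdapted F x (ofFrameMatrix F x X stdJ) := by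
  have hsk : ∀ i j, stdJ j i = -stdJ i j := fun i j => congrFun (congrFun stdJ_transpose i) j
  refine ⟨fun y => ?_, fun y z => ?_, fun ν hν y z => ?_⟩
  · have : (ofFrameMatrix F x X stdJ).comp (ofFrameMatrix F x X stdJ) =
        -ContinuousLinearMap.id ℝ E := ext_frame hE hX fun j => by
      rw [ContinuousLinearMap.comp_apply, ofFrameMatrix_frame hX]
      simp only [map_sum, map_smul, ofFrameMatrix_frame hX, Finset.smul_sum, smul_smul]
      rw [Finset.sum_comm]
      have h1 : ∀ i, ∑ k, (stdJ k j * stdJ i k) • X i = (-1 : Matrix (Fin 4) (Fin 4) ℝ) i j • X i :=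
        fun i => by
          rw [← Finset.sum_smul, ← stdJ_mul_stdJ, Matrix.mul_apply]
          simp only [mul_comm]
      simp [h1, Matrix.one_apply]
    simpa using congrArg (fun K => K y) this
  · have key : ∀ i j, inner ℝ (fderiv ℝ F x (ofFrameMatrix F x X stdJ (X i))) (fderiv ℝ F x (X j)) =
        -inner ℝ (fderiv ℝ F x (X i)) (fderiv ℝ F x (ofFrameMatrix F x X stdJ (X j))) := fun i j => by
      rw [ofFrameMatrix_frame hX, ofFrameMatrix_frame hX, inner_fderiv_sum hX, real_inner_comm,
        inner_fderiv_sum hX, hsk]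
    obtain ⟨c, rfl⟩ : ∃ c : Fin 4 → ℝ, y = ∑ i, c i • X i := ⟨_, (frame_expansion hE hX y).symm⟩
    obtain ⟨d, rfl⟩ : ∃ c : Fin 4 → ℝ, z = ∑ i, c i • X i := ⟨_, (frame_expansion hE hX z).symm⟩
    simp only [map_sum, map_smul, sum_inner, inner_sum, inner_smul_left, inner_smul_right, key,
      mul_neg, Finset.sum_neg_distrib]
  · obtain ⟨hs, hJ⟩ := QA_symm_anticomm (hQ ν hν)
    have key : ∀ i j, inner ℝ ν (fderiv ℝ (fderiv ℝ F) x (ofFrameMatrix F x X stdJ (X i)) (X j)) =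
        inner ℝ ν (fderiv ℝ (fderiv ℝ F) x (X i) (ofFrameMatrix F x X stdJ (X j))) := fun i j => by
      have h1 := congrFun (congrFun hJ i) j
      simp only [Matrix.add_apply, Matrix.mul_apply, Matrix.zero_apply, secondMatrix,
        Matrix.of_apply] at h1
      rw [ofFrameMatrix_frame hX, ofFrameMatrix_frame hX]
      simp only [map_sum, map_smul, sum_apply, smul_apply, inner_sum, inner_smul_right]
      simp only [hsk i] 
      rw [← sub_eq_zero, ← neg_eq_zero, ← h1]
      simp only [neg_mul, Finset.sum_neg_distrib, mul_comm]
      ring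
    obtain ⟨c, rfl⟩ : ∃ c : Fin 4 → ℝ, y = ∑ i, c i • X i := ⟨_, (frame_expansion hE hX y).symm⟩
    obtain ⟨d, rfl⟩ : ∃ c : Fin 4 → ℝ, z = ∑ i, c i • X i := ⟨_, (frame_expansion hE hX z).symm⟩
    simp only [map_sum, map_smul, sum_apply, smul_apply, inner_sum, inner_smul_right, key]

end Adapted

/-! ### Smooth local choice of the complex structure up to sign. -/

section LocalSmoothness

variable {E V : Type*} [NormedAddCommGroup E] [InnerProductSpace ℝ E] [FiniteDimensional ℝ E]
  [NormedAddCommGroup V] [InnerProductSpace ℝ V] [FiniteDimensional ℝ V]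

/-- The matrix, in the frame `X`, of the second fundamental form in the direction of the normal
part of `w`. -/
def normalMatrix (F : E → V) (x : E) (X : Fin 4 → E) (w : V) : Matrix (Fin 4) (Fin 4) ℝ :=
  secondMatrix F x X (w - fderiv ℝ F x (pinv (fderiv ℝ F x) w))

/-- The coefficients of the linear system for `c` that expresses that `quatMat c` anticommutes with
`S`. -/
def anticommRow (S : Matrix (Fin 4) (Fin 4) ℝ) (i j : Fin 4) : Fin 3 → ℝ :=
  ![(S * stdJ + stdJ * S) i j, (S * matT + matT * S) i j, (S * matU + matU * S) i j]

theorem anticommRow_dot {S : Matrix (Fin 4) (Fin 4) ℝ} {c : Fin 3 → ℝ}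
    (h : S * quatMat c + quatMat c * S = 0) (i j : Fin 4) :
    c 0 * anticommRow S i j 0 + c 1 * anticommRow S i j 1 + c 2 * anticommRow S i j 2 = 0 := by
  have h1 := congrFun (congrFun h i) j
  simp only [quatMat, mul_add, add_mul, Matrix.mul_smul, Matrix.smul_mul, Matrix.add_apply,
    Matrix.smul_apply, smul_eq_mul, Matrix.zero_apply] at h1
  simp [anticommRow]
  linarith

/-- A solution of two independent homogeneous equations in three unknowns is a multiple of the
cross product of the rows. -/
theorem eq_smul_of_dot_eq_zero {r s c : Fin 3 → ℝ} (hn : r 1 * s 2 - r 2 * s 1 ≠ 0)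
    (hr : c 0 * r 0 + c 1 * r 1 + c 2 * r 2 = 0) (hs : c 0 * s 0 + c 1 * s 1 + c 2 * s 2 = 0) :
    c = c 0 • ![1, (r 2 * s 0 - r 0 * s 2) / (r 1 * s 2 - r 2 * s 1),
      (r 0 * s 1 - r 1 * s 0) / (r 1 * s 2 - r 2 * s 1)] := by
  ext i
  fin_cases i
  · simp
  · simp
    rw [← mul_div_assoc, eq_div_iff hn]
    linear_combination s 2 * hr - r 2 * hs
  · simp
    rw [← mul_div_assoc, eq_div_iff hn]
    linear_combination r 1 * hs - s 1 * hr

variable {F : E → V} {x : E}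

theorem inner_normalPart (hinj : Function.Injective (fderiv ℝ F x)) (w : V) (a : E) :
    inner ℝ (w - fderiv ℝ F x (pinv (fderiv ℝ F x) w)) (fderiv ℝ F x a) = 0 :=
  inner_sub_pinv hinj w a

theorem normalPart_of_normal (hinj : Function.Injective (fderiv ℝ F x)) {ν : V}
    (hν : ∀ a, inner ℝ ν (fderiv ℝ F x a) = 0) :
    ν - fderiv ℝ F x (pinv (fderiv ℝ F x) ν) = ν := by
  have h := inner_normalPart hinj ν (pinv (fderiv ℝ F x) ν)
  rw [inner_sub_left, hν, zero_sub, neg_eq_zero, inner_self_eq_zero] at h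
  rw [h, sub_zero]

theorem contDiffAt_normalMatrix {X : E → Fin 4 → E} (hF : ContDiffAt ℝ ∞ F x)
    (hinj : Function.Injective (fderiv ℝ F x)) (hX : ∀ i, ContDiffAt ℝ ∞ (fun x => X x i) x) (w : V)
    (i j : Fin 4) : ContDiffAt ℝ ∞ (fun x => normalMatrix F x (X x) w i j) x := by
  have hD := contDiffAt_fderiv hF
  have hP := (ContDiffAt.comp x (contDiffAt_pinv hinj) hD).clm_apply (contDiffAt_const (c := w))
  exact (contDiffAt_const.sub (hD.clm_apply hP)).inner ℝ
    (((contDiffAt_fderiv hD).clm_apply (hX i)).clm_apply (hX j))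

theorem contDiffAt_anticommRow {S : E → Matrix (Fin 4) (Fin 4) ℝ}
    (hS : ∀ i j, ContDiffAt ℝ ∞ (fun x => S x i j) x) (i j : Fin 4) (k : Fin 3) :
    ContDiffAt ℝ ∞ (fun x => anticommRow (S x) i j k) x := by
  have h : ∀ A : Matrix (Fin 4) (Fin 4) ℝ, ContDiffAt ℝ ∞ (fun x => (S x * A + A * S x) i j) x := by
    intro A
    simp only [Matrix.add_apply, Matrix.mul_apply]
    exact (ContDiffAt.sum fun l _ => (hS i l).mul contDiffAt_const).add
      (ContDiffAt.sum fun l _ => contDiffAt_const.mul (hS l j))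
  fin_cases k
  · exact h stdJ
  · exact h matT
  · exact h matU

theorem contDiffAt_ofFrameMatrix {X : E → Fin 4 → E} {m : E → Matrix (Fin 4) (Fin 4) ℝ}
    (hF : ContDiffAt ℝ ∞ F x) (hX : ∀ i, ContDiffAt ℝ ∞ (fun x => X x i) x)
    (hm : ∀ i j, ContDiffAt ℝ ∞ (fun x => m x i j) x) :
    ContDiffAt ℝ ∞ (fun x => ofFrameMatrix F x (X x) (m x)) x := by
  have hD := contDiffAt_fderiv hF
  unfold ofFrameMatrix
  refine ContDiffAt.sum fun j _ => ContDiffAt.smulRight ?_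
    (ContDiffAt.sum fun i _ => (hm i j).smul (hX i))
  exact ((innerSL ℝ (E := V)).contDiff.contDiffAt.comp x (hD.clm_apply (hX j))).clm_comp hD

/-- If every minor of the T and U columns vanished, some nonzero bT + cU would anticommute with all
second fundamental forms, giving a common null vector by `mapK_mulVec_of_anticomm`. -/
theorem exists_independent_anticommRow {X : Fin 4 → E} (hinj : Function.Injective (fderiv ℝ F x))
    (hQ : ∀ ν, (∀ a, inner ℝ ν (fderiv ℝ F x a) = 0) → secondMatrix F x X ν ∈ QA)
    (hK : ∀ w, (∀ ν, (∀ a, inner ℝ ν (fderiv ℝ F x a) = 0) →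
      (mapK (secondMatrix F x X ν)).mulVec w = 0) → w = 0) :
    ∃ w i j w' i' j',
      anticommRow (normalMatrix F x X w) i j 1 * anticommRow (normalMatrix F x X w') i' j' 2 -
        anticommRow (normalMatrix F x X w) i j 2 * anticommRow (normalMatrix F x X w') i' j' 1 ≠ 0 := by
  by_contra! hcon
  obtain ⟨β, γ, hβγ, hall⟩ : ∃ β γ : ℝ, (β ≠ 0 ∨ γ ≠ 0) ∧ ∀ w i j,
      β * anticommRow (normalMatrix F x X w) i j 1 +
        γ * anticommRow (normalMatrix F x X w) i j 2 = 0 := by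
    by_cases h : ∃ w i j, anticommRow (normalMatrix F x X w) i j 1 ≠ 0 ∨
        anticommRow (normalMatrix F x X w) i j 2 ≠ 0
    · obtain ⟨w, i, j, h⟩ := h
      -- The chosen nonzero row turned by a right angle; the vanishing minors say that it is
      -- orthogonal to every row.
      refine ⟨anticommRow (normalMatrix F x X w) i j 2, -anticommRow (normalMatrix F x X w) i j 1,
        h.symm.imp_right neg_ne_zero.mpr, fun w' i' j' => ?_⟩
      have := hcon w i j w' i' j'
      linarith
    · push Not at h
      exact ⟨1, 0, Or.inl one_ne_zero, fun w i j => by rw [(h w i j).1]; simp⟩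
  have h0 := hK (Sum.elim (fun _ => γ) (fun _ => -β)) fun ν hν => by
    refine mapK_mulVec_of_anticomm (QA_symm_anticomm (hQ ν hν)).2 ?_
    ext i j
    have h1 := hall ν i j
    rw [normalMatrix, normalPart_of_normal hinj hν] at h1
    simpa [anticommRow, mul_add] using h1
  have hγ : γ = 0 := congrFun h0 (Sum.inl 0)
  have hβ : β = 0 := by simpa using congrFun h0 (Sum.inr 0)
  tauto

theorem continuousAt_frameMatrix {L : E → E →L[ℝ] E} {X : E → Fin 4 → E} (hF : ContDiffAt ℝ ∞ F x)
    (hX : ∀ i, ContDiffAt ℝ ∞ (fun x => X x i) x) (hL : ContinuousAt L x) (i j : Fin 4) :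
    ContinuousAt (fun x => frameMatrix F x (X x) (L x) i j) x := by
  have hD := (contDiffAt_fderiv hF).continuousAt
  exact (hD.clm_apply (hX i).continuousAt).inner (𝕜 := ℝ)
    (hD.clm_apply (hL.clm_apply (hX j).continuousAt))

theorem ofFrameMatrix_neg (X : Fin 4 → E) (m : Matrix (Fin 4) (Fin 4) ℝ) :
    ofFrameMatrix F x X (-m) = -ofFrameMatrix F x X m := by
  ext1 v
  simp [ofFrameMatrix_apply]

theorem quatMat_neg (c : Fin 3 → ℝ) : quatMat (-c) = -quatMat c := by
  simp [quatMat]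
  abel

theorem exists_smooth_adapted (hE : Module.finrank ℝ E = 4) {L : E → E →L[ℝ] E} {x₀ : E}
    {b : Fin 4 → E}
    (hF : ∀ᶠ x in 𝓝 x₀, ContDiffAt ℝ ∞ F x ∧ Function.Injective (fderiv ℝ F x))
    (hL : ∀ᶠ x in 𝓝 x₀, IsAdapted F x (L x))
    (hb : Orthonormal ℝ fun i => fderiv ℝ F x₀ (b i)) (hLb : L x₀ = ofFrameMatrix F x₀ b stdJ)
    (hQ : ∀ ν, (∀ a, inner ℝ ν (fderiv ℝ F x₀ a) = 0) → secondMatrix F x₀ b ν ∈ QA)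
    (hK : ∀ w, (∀ ν, (∀ a, inner ℝ ν (fderiv ℝ F x₀ a) = 0) →
      (mapK (secondMatrix F x₀ b ν)).mulVec w = 0) → w = 0)
    (hpf : ∀ᶠ x in 𝓝 x₀, pfaffian (frameMatrix F x (smoothFrame F b x) (L x)) < 0) :
    ∃ J' : E → E →L[ℝ] E,
      (∀ᶠ x in 𝓝 x₀, ContDiffAt ℝ ∞ J' x ∧ (J' x = L x ∨ J' x = -L x)) ∧
      (ContinuousAt L x₀ → ∀ᶠ x in 𝓝 x₀, J' x = L x) := by
  have hinj := hF.self_of_nhds.2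
  have hbi : LinearIndependent ℝ b :=
    LinearIndependent.of_comp (fderiv ℝ F x₀).toLinearMap hb.linearIndependent
  set X : E → Fin 4 → E := smoothFrame F b with hX
  have hX0 : X x₀ = b := smoothFrame_of_orthonormal hinj hb
  obtain ⟨w, i, j, w', i', j', hne⟩ := exists_independent_anticommRow hinj hQ hK
  set r : E → Fin 3 → ℝ := fun x => anticommRow (normalMatrix F x (X x) w) i j with hr
  set s : E → Fin 3 → ℝ := fun x => anticommRow (normalMatrix F x (X x) w') i' j' with hs
  set n : E → ℝ := fun x => r x 1 * s x 2 - r x 2 * s x 1 with hn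
  have hn0 : n x₀ ≠ 0 := by simpa only [hn, hr, hs, hX0] using hne
  have hXc : ∀ x, ContDiffAt ℝ ∞ F x → Function.Injective (fderiv ℝ F x) →
      ∀ i, ContDiffAt ℝ ∞ (fun x => X x i) x := fun x h1 h2 i => contDiffAt_smoothFrame hbi h1 h2 i
  have hrc : ∀ x, ContDiffAt ℝ ∞ F x → Function.Injective (fderiv ℝ F x) → ∀ k,
      ContDiffAt ℝ ∞ (fun x => r x k) x := fun x h1 h2 k =>
    contDiffAt_anticommRow (contDiffAt_normalMatrix h1 h2 (hXc x h1 h2) w) i j k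
  have hsc : ∀ x, ContDiffAt ℝ ∞ F x → Function.Injective (fderiv ℝ F x) → ∀ k,
      ContDiffAt ℝ ∞ (fun x => s x k) x := fun x h1 h2 k =>
    contDiffAt_anticommRow (contDiffAt_normalMatrix h1 h2 (hXc x h1 h2) w') i' j' k
  have hnc : ∀ x, ContDiffAt ℝ ∞ F x → Function.Injective (fderiv ℝ F x) →
      ContDiffAt ℝ ∞ n x := fun x h1 h2 =>
    ((hrc x h1 h2 1).mul (hsc x h1 h2 2)).sub ((hrc x h1 h2 2).mul (hsc x h1 h2 1))
  have hn_ev : ∀ᶠ x in 𝓝 x₀, n x ≠ 0 :=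
    (hnc x₀ hF.self_of_nhds.1 hinj).continuousAt.eventually_ne hn0
  -- The cross product of the two rows, scaled to have J-coefficient 1. A unit solution is then `q`
  -- divided by its norm, up to sign, and the sign is that of its J-coefficient.
  set q : E → Fin 3 → ℝ := fun x => ![1, (r x 2 * s x 0 - r x 0 * s x 2) / n x,
    (r x 0 * s x 1 - r x 1 * s x 0) / n x] with hq
  set N : E → ℝ := fun x => √(q x 0 ^ 2 + q x 1 ^ 2 + q x 2 ^ 2) with hN
  have hNpos : ∀ x, 0 < q x 0 ^ 2 + q x 1 ^ 2 + q x 2 ^ 2 := fun x => by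
    have : q x 0 = 1 := rfl
    rw [this]; positivity
  have hqc : ∀ x, ContDiffAt ℝ ∞ F x → Function.Injective (fderiv ℝ F x) → n x ≠ 0 → ∀ k,
      ContDiffAt ℝ ∞ (fun x => q x k) x := fun x h1 h2 h3 k => by
    have hr' := hrc x h1 h2
    have hs' := hsc x h1 h2
    fin_cases k
    · exact contDiffAt_const
    · exact (((hr' 2).mul (hs' 0)).sub ((hr' 0).mul (hs' 2))).div (hnc x h1 h2) h3
    · exact (((hr' 0).mul (hs' 1)).sub ((hr' 1).mul (hs' 0))).div (hnc x h1 h2) h3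
  have hNc : ∀ x, ContDiffAt ℝ ∞ F x → Function.Injective (fderiv ℝ F x) → n x ≠ 0 →
      ContDiffAt ℝ ∞ (fun x => (N x)⁻¹) x := fun x h1 h2 h3 => by
    have hq' := hqc x h1 h2 h3
    exact ((((hq' 0).pow 2).add ((hq' 1).pow 2)).add ((hq' 2).pow 2)).sqrt (hNpos x).ne' |>.inv
      (Real.sqrt_pos.mpr (hNpos x)).ne'
  have hmain : ∀ᶠ x in 𝓝 x₀, ∃ c : Fin 3 → ℝ,
      frameMatrix F x (X x) (L x) = quatMat c ∧ (c = (N x)⁻¹ • q x ∧ 0 < c 0 ∨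
        c = -((N x)⁻¹ • q x) ∧ c 0 < 0) := by
    filter_upwards [hF, hL, hpf, hn_ev] with x hFx hLx hpx hnx
    have hXo : Orthonormal ℝ fun i => fderiv ℝ F x (X x i) := orthonormal_smoothFrame hbi hFx.2
    obtain ⟨c, hc, hc1⟩ := exists_eq_quatMat (hLx.transpose_frameMatrix (X := X x))
      (hLx.frameMatrix_mul_self hE hXo) hpx
    refine ⟨c, hc, ?_⟩
    have hrow : ∀ w, normalMatrix F x (X x) w * quatMat c + quatMat c * normalMatrix F x (X x) w = 0 :=
      fun w => by
        rw [← hc]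
        exact hLx.secondMatrix_anticomm hE hXo (inner_normalPart hFx.2 w)
    have hcq : c = c 0 • q x := eq_smul_of_dot_eq_zero hnx (anticommRow_dot (hrow w) i j)
      (anticommRow_dot (hrow w') i' j')
    have hNN : (c 0 * N x) ^ 2 = 1 := by
      rw [mul_pow, hN, Real.sq_sqrt (hNpos x).le, ← hc1]
      have e1 : c 1 = c 0 * q x 1 := congrFun hcq 1
      have e2 : c 2 = c 0 * q x 2 := congrFun hcq 2
      have e0 : q x 0 = 1 := rfl
      rw [e1, e2, e0]; ring
    have hNx : 0 < N x := Real.sqrt_pos.mpr (hNpos x)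
    rcases sq_eq_sq_iff_eq_or_eq_neg.mp (hNN.trans (one_pow 2).symm) with h | h
    · have h0 : c 0 = (N x)⁻¹ := eq_inv_of_mul_eq_one_left h
      refine Or.inl ⟨h0 ▸ hcq, h0 ▸ inv_pos.mpr hNx⟩
    · have h0 : c 0 = -(N x)⁻¹ := by
        rw [← neg_eq_iff_eq_neg]
        exact eq_inv_of_mul_eq_one_left (by linarith)
      refine Or.inr ⟨?_, by rw [h0]; exact neg_lt_zero.mpr (inv_pos.mpr hNx)⟩
      rw [← neg_smul, ← h0]; exact hcq
  refine ⟨fun x => ofFrameMatrix F x (X x) (quatMat ((N x)⁻¹ • q x)), ?_, fun hLc => ?_⟩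
  · filter_upwards [hF, hn_ev, hmain] with x hFx hnx ⟨c, hc, hsign⟩
    have hXo : Orthonormal ℝ fun i => fderiv ℝ F x (X x i) := orthonormal_smoothFrame hbi hFx.2
    refine ⟨contDiffAt_ofFrameMatrix hFx.1 (hXc x hFx.1 hFx.2) fun i j => ?_, ?_⟩
    · have hq' := fun k => (hNc x hFx.1 hFx.2 hnx).mul (hqc x hFx.1 hFx.2 hnx k)
      exact (((hq' 0).mul contDiffAt_const).add ((hq' 1).mul contDiffAt_const)).add
        ((hq' 2).mul contDiffAt_const)
    · rw [← ofFrameMatrix_frameMatrix hE hXo (L x), hc]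
      rcases hsign with ⟨h, -⟩ | ⟨h, -⟩
      · exact Or.inl (by rw [h])
      · right
        rw [h, quatMat_neg, ofFrameMatrix_neg, neg_neg]
  -- Entry (2, 0) of `quatMat c` is the J-coefficient `c 0`. It equals 1 at the base point, so
  -- continuity keeps it positive and selects the sign.
  · have hc0 := continuousAt_frameMatrix hF.self_of_nhds.1 (hXc x₀ hF.self_of_nhds.1 hinj) hLc 2 0
    have hpos : 0 < frameMatrix F x₀ (X x₀) (L x₀) 2 0 := by
      rw [hX0, hLb, frameMatrix_ofFrameMatrix hb]
      simp [stdJ]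
    filter_upwards [hF, hmain, hc0.eventually (lt_mem_nhds hpos)] with x hFx ⟨c, hc, hsign⟩ hx
    have hXo : Orthonormal ℝ fun i => fderiv ℝ F x (X x i) := orthonormal_smoothFrame hbi hFx.2
    rw [← ofFrameMatrix_frameMatrix hE hXo (L x), hc]
    have hx' : 0 < c 0 := by
      rw [hc] at hx
      simpa [quatMat, stdJ, matT, matU] using hx
    rcases hsign with ⟨h, -⟩ | ⟨-, h⟩
    · rw [h]
    · linarith

theorem pfaffian_neg_of_continuousAt {L : E → E →L[ℝ] E} {b : Fin 4 → E}
    (hF : ContDiffAt ℝ ∞ F x) (hinj : Function.Injective (fderiv ℝ F x))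
    (hb : Orthonormal ℝ fun i => fderiv ℝ F x (b i)) (hLb : L x = ofFrameMatrix F x b stdJ)
    (hL : ContinuousAt L x) :
    ∀ᶠ y in 𝓝 x, pfaffian (frameMatrix F y (smoothFrame F b y) (L y)) < 0 := by
  have hbi : LinearIndependent ℝ b :=
    LinearIndependent.of_comp (fderiv ℝ F x).toLinearMap hb.linearIndependent
  have hc := continuousAt_frameMatrix hF (contDiffAt_smoothFrame hbi hF hinj) hL
  have hp : ContinuousAt (fun y => pfaffian (frameMatrix F y (smoothFrame F b y) (L y))) x :=
    (((hc 0 1).mul (hc 2 3)).sub ((hc 0 2).mul (hc 1 3))).add ((hc 0 3).mul (hc 1 2))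
  refine hp.eventually (gt_mem_nhds ?_)
  beta_reduce
  rw [smoothFrame_of_orthonormal hinj hb, hLb, frameMatrix_ofFrameMatrix hb]
  simp [pfaffian, stdJ]

/-- Compare `e y` with the smooth frame through a matrix `R`: in the smooth frame `J` becomes R J
Rᵀ, with Pfaffian -det R. The Gram matrix factors as `G y * R`, and det G is positive near `x`
because `G x = 1`; hence det R > 0. -/
theorem pfaffian_neg_of_det_pos (hE : Module.finrank ℝ E = 4) {e : E → Fin 4 → E}
    (hF : ∀ᶠ y in 𝓝 x, ContDiffAt ℝ ∞ F y ∧ Function.Injective (fderiv ℝ F y))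
    (he : ∀ᶠ y in 𝓝 x, Orthonormal ℝ fun i => fderiv ℝ F y (e y i))
    (hdet : ∀ᶠ y in 𝓝 x, 0 < (Matrix.of fun i j =>
      inner ℝ (fderiv ℝ F x (e x i)) (fderiv ℝ F y (e y j)) : Matrix (Fin 4) (Fin 4) ℝ).det) :
    ∀ᶠ y in 𝓝 x, pfaffian (frameMatrix F y (smoothFrame F (e x) y)
      (ofFrameMatrix F y (e y) stdJ)) < 0 := by
  have hb := he.self_of_nhds
  have hinj := hF.self_of_nhds.2
  have hbi : LinearIndependent ℝ (e x) :=
    LinearIndependent.of_comp (fderiv ℝ F x).toLinearMap hb.linearIndependent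
  have hXc := contDiffAt_smoothFrame hbi hF.self_of_nhds.1 hinj
  set G : E → Matrix (Fin 4) (Fin 4) ℝ := fun y => Matrix.of fun i k =>
    inner ℝ (fderiv ℝ F x (e x i)) (fderiv ℝ F y (smoothFrame F (e x) y k)) with hG
  have hGc : ContinuousAt (fun y => (G y).det) x := by
    have : ContinuousAt G x := continuousAt_pi.mpr fun i => continuousAt_pi.mpr fun k =>
      ContinuousAt.inner (𝕜 := ℝ) continuousAt_const
        ((contDiffAt_fderiv hF.self_of_nhds.1).continuousAt.clm_apply (hXc k).continuousAt)
    exact (continuous_id.matrix_det).continuousAt.comp this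
  have hG1 : G x = 1 := by
    ext i k
    simp only [hG, smoothFrame_of_orthonormal hinj hb, Matrix.of_apply,
      orthonormal_iff_ite.mp hb, Matrix.one_apply]
  have hGpos : ∀ᶠ y in 𝓝 x, 0 < (G y).det :=
    hGc.eventually (lt_mem_nhds (by simp [hG1]))
  filter_upwards [hF, hdet, hGpos] with y hFy hdy hGy
  have hXo : Orthonormal ℝ fun i => fderiv ℝ F y (smoothFrame F (e x) y i) :=
    orthonormal_smoothFrame hbi hFy.2
  set R : Matrix (Fin 4) (Fin 4) ℝ := Matrix.of fun k j =>
    inner ℝ (fderiv ℝ F y (smoothFrame F (e x) y k)) (fderiv ℝ F y (e y j)) with hR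
  have h1 : frameMatrix F y (smoothFrame F (e x) y) (ofFrameMatrix F y (e y) stdJ) =
      R * stdJ * Rᵀ := by
    ext i j
    simp only [frameMatrix, Matrix.of_apply, ofFrameMatrix_apply, map_sum, map_smul, inner_sum,
      inner_smul_right, Matrix.mul_apply, Matrix.transpose_apply, hR, Finset.sum_mul]
    refine Finset.sum_congr rfl fun k _ => ?_
    rw [Finset.mul_sum]
    exact Finset.sum_congr rfl fun l _ => by rw [real_inner_comm (fderiv ℝ F y (e y k))]; ring
  have h2 : (Matrix.of fun i j => inner ℝ (fderiv ℝ F x (e x i)) (fderiv ℝ F y (e y j)) :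
      Matrix (Fin 4) (Fin 4) ℝ) = G y * R := by
    ext i j
    rw [Matrix.of_apply, Matrix.mul_apply]
    conv_lhs => rw [← frame_expansion hE hXo (e y j)]
    simp only [map_sum, map_smul, inner_sum, inner_smul_right, hG, hR, Matrix.of_apply, mul_comm]
  rw [h2, Matrix.det_mul] at hdy
  rw [h1, pfaffian_conj_stdJ, neg_lt_zero]
  exact (mul_pos_iff_of_pos_left hGy).mp hdy

end LocalSmoothness

/-! ### Changes of charts and the differential of the immersion. -/

theorem second_fderiv_comp {E E' G : Type*} [NormedAddCommGroup E] [NormedSpace ℝ E]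
    [NormedAddCommGroup E'] [NormedSpace ℝ E'] [NormedAddCommGroup G] [NormedSpace ℝ G]
    {F : E' → G} {ψ : E → E'} {x : E} (hF : ContDiffAt ℝ ∞ F (ψ x)) (hψ : ContDiffAt ℝ ∞ ψ x)
    (u v : E) : fderiv ℝ (fderiv ℝ (F ∘ ψ)) x u v =
      fderiv ℝ (fderiv ℝ F) (ψ x) (fderiv ℝ ψ x u) (fderiv ℝ ψ x v) +
        fderiv ℝ F (ψ x) (fderiv ℝ (fderiv ℝ ψ) x u v) := by
  have h1 : fderiv ℝ (F ∘ ψ) =ᶠ[𝓝 x] fun x => (fderiv ℝ F (ψ x)).comp (fderiv ℝ ψ x) := by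
    have hψ1 : ContDiffAt ℝ 1 ψ x := hψ.of_le (by norm_cast)
    have hF1 : ContDiffAt ℝ 1 F (ψ x) := hF.of_le (by norm_cast)
    filter_upwards [hψ1.eventually (by simp), hψ.continuousAt.eventually (hF1.eventually (by simp))]
      with x hx1 hx2
    exact fderiv_comp _ (hx2.differentiableAt one_ne_zero) (hx1.differentiableAt one_ne_zero)
  have hDF := (differentiableAt_of_contDiffAt_infty (contDiffAt_fderiv hF)).hasFDerivAt
  have hDψ := (differentiableAt_of_contDiffAt_infty (contDiffAt_fderiv hψ)).hasFDerivAt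
  have hψ0 := (differentiableAt_of_contDiffAt_infty hψ).hasFDerivAt
  have h2 : HasFDerivAt (fun x => (fderiv ℝ F (ψ x)).comp (fderiv ℝ ψ x)) _ x :=
    (HasFDerivAt.comp x hDF hψ0).clm_comp hDψ
  rw [h1.fderiv_eq, h2.fderiv]
  simp [add_comm]

section Charts

variable {M : Type*} [TopologicalSpace M] [ChartedSpace (EuclideanSpace ℝ (Fin 4)) M]
  [IsManifold (𝓡 4) ∞ M] {r : ℕ}

/-- The map `f` in the preferred chart at `p`. -/
def chartMap (f : M → Ambient r) (p : M) : EuclideanSpace ℝ (Fin 4) → Ambient r :=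
  f ∘ (extChartAt (𝓡 4) p).symm

/-- The identification of the tangent space at `q` with `ℝ⁴` by the chart at `p`. -/
def toCoord (p q : M) : Tan q →L[ℝ] EuclideanSpace ℝ (Fin 4) :=
  tangentCoordChange (𝓡 4) q p q

/-- The inverse of `toCoord`. -/
def ofCoord (p q : M) : EuclideanSpace ℝ (Fin 4) →L[ℝ] Tan q :=
  tangentCoordChange (𝓡 4) p q q

omit [IsManifold (𝓡 4) ∞ M] in
theorem finrank_model : Module.finrank ℝ (EuclideanSpace ℝ (Fin 4)) = 4 := by simp

variable {f : M → Ambient r} {p q : M}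

theorem ofCoord_toCoord (hq : q ∈ (extChartAt (𝓡 4) p).source) (v : Tan q) :
    ofCoord p q (toCoord p q v) = v := by
  have h := tangentCoordChange_comp (I := 𝓡 4) (w := q) (x := p) (y := q) (z := q) (v := v)
    ⟨⟨mem_extChartAt_source q, hq⟩, mem_extChartAt_source q⟩
  exact h.trans (tangentCoordChange_self (mem_extChartAt_source q))

theorem toCoord_ofCoord (hq : q ∈ (extChartAt (𝓡 4) p).source) (v : EuclideanSpace ℝ (Fin 4)) :
    toCoord p q (ofCoord p q v) = v := by
  have h := tangentCoordChange_comp (I := 𝓡 4) (w := p) (x := q) (y := p) (z := q) (v := v)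
    ⟨⟨hq, mem_extChartAt_source q⟩, hq⟩
  exact h.trans (tangentCoordChange_self hq)

theorem toCoord_self (v : EuclideanSpace ℝ (Fin 4)) : toCoord p p v = v := by
  have h := tangentCoordChange_self (I := 𝓡 4) (v := v) (mem_extChartAt_source p)
  exact h

theorem ofCoord_self (v : EuclideanSpace ℝ (Fin 4)) : ofCoord p p v = v := by
  have h := tangentCoordChange_self (I := 𝓡 4) (v := v) (mem_extChartAt_source p)
  exact h

theorem contDiffAt_chartMap (hf : IsSmoothImmersion f) {x : EuclideanSpace ℝ (Fin 4)}
    (hx : x ∈ (extChartAt (𝓡 4) p).target) : ContDiffAt ℝ ∞ (chartMap f p) x := by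
  have h : ContMDiffOn (𝓡 4) (𝓡 (4 + r)) ∞ (chartMap f p) (extChartAt (𝓡 4) p).target :=
    hf.1.comp_contMDiffOn (contMDiffOn_extChartAt_symm p)
  exact (contMDiffOn_iff_contDiffOn.mp h).contDiffAt ((isOpen_extChartAt_target p).mem_nhds hx)

omit [IsManifold (𝓡 4) ∞ M] in
theorem push_eq_fderiv_self (hf : IsSmoothImmersion f) (q : M) :
    push f q = fderiv ℝ (chartMap f q) (extChartAt (𝓡 4) q q) := by
  have h : MDifferentiableAt (𝓡 4) (𝓡 (4 + r)) f q := (hf.1 q).mdifferentiableAt (by simp)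
  have h1 : writtenInExtChartAt (𝓡 4) (𝓡 (4 + r)) q f = chartMap f q := by
    ext1 x
    simp [writtenInExtChartAt, chartMap]
    rfl
  have h2 := h.mfderiv
  rw [h1, ModelWithCorners.range_eq_univ, fderivWithin_univ] at h2
  exact h2

/-- The change of charts from `q` to `p`. -/
def chartChange (p q : M) : EuclideanSpace ℝ (Fin 4) → EuclideanSpace ℝ (Fin 4) :=
  extChartAt (𝓡 4) p ∘ (extChartAt (𝓡 4) q).symm

omit [IsManifold (𝓡 4) ∞ M] in
theorem chartChange_apply : chartChange p q (extChartAt (𝓡 4) q q) = extChartAt (𝓡 4) p q := by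
  simp [chartChange]

theorem contDiffAt_chartChange (hq : q ∈ (extChartAt (𝓡 4) p).source) :
    ContDiffAt ℝ ∞ (chartChange p q) (extChartAt (𝓡 4) q q) := by
  have h := contDiffWithinAt_ext_coord_change (I := 𝓡 4) (n := ∞) p q
    (y := extChartAt (𝓡 4) q q) (by
      rw [PartialEquiv.trans_source'', PartialEquiv.symm_symm, PartialEquiv.symm_target]
      exact ⟨q, ⟨mem_extChartAt_source q, hq⟩, rfl⟩)
  rw [ModelWithCorners.range_eq_univ, contDiffWithinAt_univ] at h
  exact h

omit [IsManifold (𝓡 4) ∞ M] in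
theorem chartMap_eventuallyEq (hq : q ∈ (extChartAt (𝓡 4) p).source) :
    chartMap f q =ᶠ[𝓝 (extChartAt (𝓡 4) q q)] chartMap f p ∘ chartChange p q := by
  have hc : ContinuousAt (extChartAt (𝓡 4) q).symm (extChartAt (𝓡 4) q q) :=
    continuousAt_extChartAt_symm q
  have hs : (extChartAt (𝓡 4) p).source ∈ 𝓝 ((extChartAt (𝓡 4) q).symm (extChartAt (𝓡 4) q q)) := by
    rw [extChartAt_to_inv]
    exact (isOpen_extChartAt_source p).mem_nhds hq
  filter_upwards [hc.preimage_mem_nhds hs] with y hy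
  simp only [chartMap, chartChange, Function.comp_apply]
  rw [(extChartAt (𝓡 4) p).left_inv hy]

theorem fderiv_chartChange :
    fderiv ℝ (chartChange p q) (extChartAt (𝓡 4) q q) = toCoord p q := by
  have h := tangentCoordChange_def (I := 𝓡 4) (x := q) (y := p) (z := q)
  rw [ModelWithCorners.range_eq_univ, fderivWithin_univ] at h
  exact h.symm

theorem push_eq (hf : IsSmoothImmersion f) (hq : q ∈ (extChartAt (𝓡 4) p).source) (v : Tan q) :
    push f q v = fderiv ℝ (chartMap f p) (extChartAt (𝓡 4) p q) (toCoord p q v) := by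
  have hF : ContDiffAt ℝ ∞ (chartMap f p) (chartChange p q (extChartAt (𝓡 4) q q)) := by
    rw [chartChange_apply]
    exact contDiffAt_chartMap hf ((extChartAt (𝓡 4) p).map_source hq)
  rw [push_eq_fderiv_self hf, (chartMap_eventuallyEq hq).fderiv_eq,
    fderiv_comp _ (differentiableAt_of_contDiffAt_infty hF)
      (differentiableAt_of_contDiffAt_infty (contDiffAt_chartChange hq)), fderiv_chartChange,
    chartChange_apply]
  rfl

/-- Changing charts alters the second derivative only by a tangential vector, so its normal part may
be computed in one fixed chart at all nearby points. -/
theorem second_fderiv_chartMap (hf : IsSmoothImmersion f) (hq : q ∈ (extChartAt (𝓡 4) p).source)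
    (u v : Tan q) : ∃ a, fderiv ℝ (fderiv ℝ (chartMap f q)) (extChartAt (𝓡 4) q q) u v =
      fderiv ℝ (fderiv ℝ (chartMap f p)) (extChartAt (𝓡 4) p q) (toCoord p q u) (toCoord p q v) +
      fderiv ℝ (chartMap f p) (extChartAt (𝓡 4) p q) a := by
  have hF : ContDiffAt ℝ ∞ (chartMap f p) (chartChange p q (extChartAt (𝓡 4) q q)) := by
    rw [chartChange_apply]
    exact contDiffAt_chartMap hf ((extChartAt (𝓡 4) p).map_source hq)
  have h := second_fderiv_comp hF (contDiffAt_chartChange hq) u v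
  rw [fderiv_chartChange, chartChange_apply] at h
  refine ⟨_, Eq.trans ?_ h⟩
  rw [(chartMap_eventuallyEq hq).fderiv.fderiv_eq]

end Charts

/-! ### Frames, endomorphism fields and the Levi-Civita connection in a chart. -/

section Coordinates

variable {M : Type*} [TopologicalSpace M] [ChartedSpace (EuclideanSpace ℝ (Fin 4)) M]
  [IsManifold (𝓡 4) ∞ M] {r : ℕ} {f : M → Ambient r} {p q : M}

theorem contMDiffAt_iff_contDiffAt_comp_symm {G : Type*} [NormedAddCommGroup G] [NormedSpace ℝ G]
    {g : M → G} (hq : q ∈ (extChartAt (𝓡 4) p).source) :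
    ContMDiffAt (𝓡 4) 𝓘(ℝ, G) ∞ g q ↔
      ContDiffAt ℝ ∞ (g ∘ (extChartAt (𝓡 4) p).symm) (extChartAt (𝓡 4) p q) := by
  have hx := (extChartAt (𝓡 4) p).map_source hq
  constructor
  · intro h
    rw [← contMDiffAt_iff_contDiffAt]
    have hs : ContMDiffAt 𝓘(ℝ, EuclideanSpace ℝ (Fin 4)) (𝓡 4) ∞ (extChartAt (𝓡 4) p).symm
        (extChartAt (𝓡 4) p q) :=
      (contMDiffOn_extChartAt_symm p).contMDiffAt ((isOpen_extChartAt_target p).mem_nhds hx)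
    refine ContMDiffAt.comp _ ?_ hs
    rwa [(extChartAt (𝓡 4) p).left_inv hq]
  · intro h
    rw [← contMDiffAt_iff_contDiffAt] at h
    have hφ : ContMDiffAt (𝓡 4) 𝓘(ℝ, EuclideanSpace ℝ (Fin 4)) ∞ (extChartAt (𝓡 4) p) q :=
      contMDiffAt_extChartAt' (by rwa [← extChartAt_source (𝓡 4)])
    refine (ContMDiffAt.comp q h hφ).congr_of_eventuallyEq ?_
    filter_upwards [(isOpen_extChartAt_source (I := 𝓡 4) p).mem_nhds hq] with y hy
    simp only [Function.comp_apply]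
    rw [(extChartAt (𝓡 4) p).left_inv hy]

/-- A field of frames in the chart at `p`. -/
def coordFrame (e : ∀ q : M, Fin 4 → Tan q) (p : M) (x : EuclideanSpace ℝ (Fin 4)) (i : Fin 4) :
    EuclideanSpace ℝ (Fin 4) :=
  toCoord p ((extChartAt (𝓡 4) p).symm x) (e ((extChartAt (𝓡 4) p).symm x) i)

/-- A field of endomorphisms in the chart at `p`. -/
def coordEnd (J : ∀ q : M, Tan q →L[ℝ] Tan q) (p : M) (x : EuclideanSpace ℝ (Fin 4)) :
    EuclideanSpace ℝ (Fin 4) →L[ℝ] EuclideanSpace ℝ (Fin 4) :=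
  (toCoord p ((extChartAt (𝓡 4) p).symm x)).comp
    ((J ((extChartAt (𝓡 4) p).symm x)).comp (ofCoord p ((extChartAt (𝓡 4) p).symm x)))

/-- A vector field in the chart at `p`. -/
def coordField (Y : ∀ q : M, Tan q) (p : M) (x : EuclideanSpace ℝ (Fin 4)) :
    EuclideanSpace ℝ (Fin 4) :=
  toCoord p ((extChartAt (𝓡 4) p).symm x) (Y ((extChartAt (𝓡 4) p).symm x))

theorem contDiffAt_coordField {Y : ∀ q : M, Tan q}
    (hY : ContMDiffAt (𝓡 4) (𝓡 4).tangent ∞ (fun q => (⟨q, Y q⟩ : TangentBundle (𝓡 4) M)) p) :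
    ContDiffAt ℝ ∞ (coordField Y p) (extChartAt (𝓡 4) p p) :=
  (contMDiffAt_iff_contDiffAt_comp_symm (mem_extChartAt_source p)).mp
    ((Bundle.contMDiffAt_section p).mp hY)

theorem inCoordinates_eq_coordEnd (J : ∀ q : M, Tan q →L[ℝ] Tan q)
    (hq : q ∈ (extChartAt (𝓡 4) p).source) :
    ContinuousLinearMap.inCoordinates (EuclideanSpace ℝ (Fin 4)) (fun q : M => TangentSpace (𝓡 4) q)
      (EuclideanSpace ℝ (Fin 4)) (fun q : M => TangentSpace (𝓡 4) q) p q p q (J q) =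
      coordEnd J p (extChartAt (𝓡 4) p q) := by
  rw [coordEnd, (extChartAt (𝓡 4) p).left_inv hq]
  rw [extChartAt_source] at hq
  exact inTangentCoordinates_eq (I := 𝓡 4) (I' := 𝓡 4) (fun q : M => q) (fun q : M => q)
    (fun q => J q) hq hq

theorem contMDiffAt_endSection_iff (J : ∀ q : M, Tan q →L[ℝ] Tan q)
    (hq : q ∈ (extChartAt (𝓡 4) p).source) :
    ContMDiffAt (𝓡 4)
      ((𝓡 4).prod 𝓘(ℝ, EuclideanSpace ℝ (Fin 4) →L[ℝ] EuclideanSpace ℝ (Fin 4))) ∞ (endSection J) q ↔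
      ContDiffAt ℝ ∞ (coordEnd J p) (extChartAt (𝓡 4) p q) := by
  have hb : q ∈ (trivializationAt (EuclideanSpace ℝ (Fin 4) →L[ℝ] EuclideanSpace ℝ (Fin 4))
      (fun q : M => TangentSpace (𝓡 4) q →L[ℝ] TangentSpace (𝓡 4) q) p).baseSet := by
    rw [hom_trivializationAt_baseSet]
    rw [extChartAt_source] at hq
    exact ⟨hq, hq⟩
  have h := Bundle.Trivialization.contMDiffAt_section_iff (IB := 𝓡 4) (n := ∞) (s := J) _ hb
  refine h.trans ?_
  rw [contMDiffAt_iff_contDiffAt_comp_symm hq]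
  have heq : (fun x => (trivializationAt (EuclideanSpace ℝ (Fin 4) →L[ℝ] EuclideanSpace ℝ (Fin 4))
      (fun q : M => TangentSpace (𝓡 4) q →L[ℝ] TangentSpace (𝓡 4) q) p ⟨x, J x⟩).2) ∘
      (extChartAt (𝓡 4) p).symm =ᶠ[𝓝 (extChartAt (𝓡 4) p q)] coordEnd J p := by
    filter_upwards [(isOpen_extChartAt_target (I := 𝓡 4) p).mem_nhds
      ((extChartAt (𝓡 4) p).map_source hq)] with x hx
    have h1 := inCoordinates_eq_coordEnd J ((extChartAt (𝓡 4) p).map_target hx)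
    rw [(extChartAt (𝓡 4) p).right_inv hx] at h1
    exact h1
  exact ⟨fun h => h.congr_of_eventuallyEq heq.symm, fun h => h.congr_of_eventuallyEq heq⟩

theorem continuousAt_coordEnd {J : ∀ q : M, Tan q →L[ℝ] Tan q} (hJ : ContinuousAt (endSection J) p) :
    ContinuousAt (coordEnd J p) (extChartAt (𝓡 4) p p) := by
  have h := ((continuousAt_hom_bundle (RingHom.id ℝ) _).mp hJ).2
  have h2 : ContinuousAt (extChartAt (𝓡 4) p).symm (extChartAt (𝓡 4) p p) :=
    continuousAt_extChartAt_symm p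
  have h3 := ContinuousAt.comp (x := extChartAt (𝓡 4) p p) (by rwa [extChartAt_to_inv]) h2
  refine h3.congr ?_
  filter_upwards [extChartAt_target_mem_nhds (I := 𝓡 4) p] with x hx
  have h1 := inCoordinates_eq_coordEnd J ((extChartAt (𝓡 4) p).map_target hx)
  rw [(extChartAt (𝓡 4) p).right_inv hx] at h1
  exact h1

theorem push_symm (hf : IsSmoothImmersion f) {x : EuclideanSpace ℝ (Fin 4)}
    (hx : x ∈ (extChartAt (𝓡 4) p).target) (v : Tan ((extChartAt (𝓡 4) p).symm x)) :
    push f ((extChartAt (𝓡 4) p).symm x) v =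
      fderiv ℝ (chartMap f p) x (toCoord p ((extChartAt (𝓡 4) p).symm x) v) := by
  have h := push_eq hf ((extChartAt (𝓡 4) p).map_target hx) v
  rwa [(extChartAt (𝓡 4) p).right_inv hx] at h

theorem fderiv_chartMap_apply (hf : IsSmoothImmersion f) {x : EuclideanSpace ℝ (Fin 4)}
    (hx : x ∈ (extChartAt (𝓡 4) p).target) (y : EuclideanSpace ℝ (Fin 4)) :
    fderiv ℝ (chartMap f p) x y =
      push f ((extChartAt (𝓡 4) p).symm x) (ofCoord p ((extChartAt (𝓡 4) p).symm x) y) := by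
  rw [push_symm hf hx, toCoord_ofCoord ((extChartAt (𝓡 4) p).map_target hx)]

theorem injective_fderiv_chartMap (hf : IsSmoothImmersion f) {x : EuclideanSpace ℝ (Fin 4)}
    (hx : x ∈ (extChartAt (𝓡 4) p).target) : Function.Injective (fderiv ℝ (chartMap f p) x) := by
  intro y z h
  rw [fderiv_chartMap_apply hf hx, fderiv_chartMap_apply hf hx] at h
  have h1 := congrArg (toCoord p ((extChartAt (𝓡 4) p).symm x)) (hf.2 _ h)
  rwa [toCoord_ofCoord ((extChartAt (𝓡 4) p).map_target hx),
    toCoord_ofCoord ((extChartAt (𝓡 4) p).map_target hx)] at h1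

theorem mem_normal_iff (hf : IsSmoothImmersion f) {x : EuclideanSpace ℝ (Fin 4)}
    (hx : x ∈ (extChartAt (𝓡 4) p).target) {ν : Ambient r} :
    ν ∈ (tangentPlane f ((extChartAt (𝓡 4) p).symm x))ᗮ ↔
      ∀ a, inner ℝ ν (fderiv ℝ (chartMap f p) x a) = 0 := by
  rw [Submodule.mem_orthogonal']
  constructor
  · intro h a
    rw [fderiv_chartMap_apply hf hx]
    exact h _ ⟨_, rfl⟩
  · rintro h _ ⟨v, rfl⟩
    exact (congrArg (inner ℝ ν) (push_symm hf hx v)).trans (h _)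

theorem secondFormMatrix_eq (hf : IsSmoothImmersion f) (e : ∀ q : M, Fin 4 → Tan q)
    {x : EuclideanSpace ℝ (Fin 4)} (hx : x ∈ (extChartAt (𝓡 4) p).target) {ν : Ambient r}
    (hν : ∀ a, inner ℝ ν (fderiv ℝ (chartMap f p) x a) = 0) :
    secondFormMatrix f ((extChartAt (𝓡 4) p).symm x) (e ((extChartAt (𝓡 4) p).symm x)) ν =
      secondMatrix (chartMap f p) x (coordFrame e p x) ν := by
  ext i j
  have hq := (extChartAt (𝓡 4) p).map_target hx
  have hν' := (mem_normal_iff hf hx).mpr hν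
  obtain ⟨a, ha⟩ := second_fderiv_chartMap hf hq (e _ i) (e _ j)
  rw [(extChartAt (𝓡 4) p).right_inv hx] at ha
  simp only [secondFormMatrix, secondMatrix, Matrix.of_apply, secondForm]
  rw [← Submodule.inner_starProjection_left_eq_right,
    Submodule.starProjection_eq_self_iff.mpr hν']
  refine (congrArg (inner ℝ ν) ha).trans ?_
  rw [inner_add_right, hν, add_zero]
  rfl

theorem orthonormal_coordFrame (hf : IsSmoothImmersion f) {e : ∀ q : M, Fin 4 → Tan q}
    (he : ∀ q, IsTypeAFrame f q (e q)) {x : EuclideanSpace ℝ (Fin 4)}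
    (hx : x ∈ (extChartAt (𝓡 4) p).target) :
    Orthonormal ℝ fun i => fderiv ℝ (chartMap f p) x (coordFrame e p x i) := by
  simp only [coordFrame, ← push_symm hf hx]
  exact (he _).1

theorem secondMatrix_mem_QA (hf : IsSmoothImmersion f) {e : ∀ q : M, Fin 4 → Tan q}
    (he : ∀ q, IsTypeAFrame f q (e q)) {x : EuclideanSpace ℝ (Fin 4)}
    (hx : x ∈ (extChartAt (𝓡 4) p).target) {ν : Ambient r}
    (hν : ∀ a, inner ℝ ν (fderiv ℝ (chartMap f p) x a) = 0) :
    secondMatrix (chartMap f p) x (coordFrame e p x) ν ∈ QA := by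
  rw [← secondFormMatrix_eq hf e hx hν]
  exact (he _).2 (Submodule.subset_span ⟨ν, (mem_normal_iff hf hx).mpr hν, rfl⟩)

theorem mapK_add (S S' : Matrix (Fin 4) (Fin 4) ℝ) : mapK (S + S') = mapK S + mapK S' := by
  ext i (j | j) <;> simp [mapK, add_mul, mul_add] <;> ring

theorem mapK_smul (c : ℝ) (S : Matrix (Fin 4) (Fin 4) ℝ) : mapK (c • S) = c • mapK S := by
  ext i (j | j) <;> simp [mapK] <;> ring

/-- `mapK` is linear, so annihilation by the spanning matrices passes to the whole space. -/
theorem eq_zero_of_secondMatrix (hf : IsSmoothImmersion f) {e : ∀ q : M, Fin 4 → Tan q}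
    {x : EuclideanSpace ℝ (Fin 4)} (hx : x ∈ (extChartAt (𝓡 4) p).target)
    (hK : ∀ q, HasTrivialCommonNullspace (secondFormSpace f q (e q))) (w : Fin 4 ⊕ Fin 4 → ℝ)
    (h : ∀ ν, (∀ a, inner ℝ ν (fderiv ℝ (chartMap f p) x a) = 0) →
      (mapK (secondMatrix (chartMap f p) x (coordFrame e p x) ν)).mulVec w = 0) : w = 0 := by
  refine hK ((extChartAt (𝓡 4) p).symm x) w fun S hS => ?_
  induction hS using Submodule.span_induction with
  | mem S hS =>
    obtain ⟨ν, hν, rfl⟩ := hS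
    have hν' := (mem_normal_iff hf hx).mp hν
    rw [secondFormMatrix_eq hf e hx hν']
    exact h ν hν'
  | zero => simp [mapK]
  | add S S' _ _ h1 h2 => rw [mapK_add, Matrix.add_mulVec, h1, h2, add_zero]
  | smul c S _ h1 => rw [mapK_smul, Matrix.smul_mulVec, h1, smul_zero]

omit [IsManifold (𝓡 4) ∞ M] in
theorem frameJ_apply (b : Fin 4 → Tan q) (v : Tan q) : frameJ f q b v =
    ∑ j, (inner ℝ (push f q (b j)) (push f q v) : ℝ) • ∑ i, stdJ i j • b i := by
  unfold frameJ
  rw [sum_apply]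
  rfl

theorem coordEnd_apply (J : ∀ q : M, Tan q →L[ℝ] Tan q) (x y : EuclideanSpace ℝ (Fin 4)) :
    coordEnd J p x y = toCoord p ((extChartAt (𝓡 4) p).symm x)
      (J ((extChartAt (𝓡 4) p).symm x) (ofCoord p ((extChartAt (𝓡 4) p).symm x) y)) :=
  rfl

theorem coordEnd_self (J : ∀ q : M, Tan q →L[ℝ] Tan q) (y : EuclideanSpace ℝ (Fin 4)) :
    coordEnd J p (extChartAt (𝓡 4) p p) y = (J p y : EuclideanSpace ℝ (Fin 4)) := by
  have h1 : coordEnd J p (extChartAt (𝓡 4) p p) y = toCoord p p (J p (ofCoord p p y)) := by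
    rw [coordEnd, extChartAt_to_inv]
    rfl
  exact h1.trans ((toCoord_self _).trans (congrArg (J p) (ofCoord_self y)))

theorem coordEnd_frameJ (hf : IsSmoothImmersion f) (e : ∀ q : M, Fin 4 → Tan q)
    {x : EuclideanSpace ℝ (Fin 4)} (hx : x ∈ (extChartAt (𝓡 4) p).target) :
    coordEnd (fun q => frameJ f q (e q)) p x =
      ofFrameMatrix (chartMap f p) x (coordFrame e p x) stdJ := by
  ext1 y
  rw [ofFrameMatrix_apply, coordEnd_apply, frameJ_apply]
  simp only [coordFrame, ← push_symm hf hx, fderiv_chartMap_apply hf hx y, map_sum, map_smul]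

/-- The derivative of dF(Y) is dF(∂Y) plus the second derivative of `F` on u and Y; projecting the
latter to the tangent plane gives the Christoffel term. -/
theorem leviCivita_eq (hf : IsSmoothImmersion f) {Y : ∀ q : M, Tan q}
    (hY : DifferentiableAt ℝ (coordField Y p) (extChartAt (𝓡 4) p p)) (u : Tan p) :
    leviCivita f Y p u = (fderiv ℝ (coordField Y p) (extChartAt (𝓡 4) p p) u +
      christoffel (chartMap f p) (extChartAt (𝓡 4) p p) u
        (coordField Y p (extChartAt (𝓡 4) p p)) : EuclideanSpace ℝ (Fin 4)) := by
  set x₀ := extChartAt (𝓡 4) p p with hx₀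
  have hx₀t : x₀ ∈ (extChartAt (𝓡 4) p).target := mem_extChartAt_target p
  have hF : ContDiffAt ℝ ∞ (chartMap f p) x₀ := contDiffAt_chartMap hf hx₀t
  have hinj := injective_fderiv_chartMap hf hx₀t
  have hpush : push f p = fderiv ℝ (chartMap f p) x₀ := push_eq_fderiv_self hf p
  have hD := (differentiableAt_of_contDiffAt_infty (contDiffAt_fderiv hF)).hasFDerivAt
  have hW : HasFDerivAt (fun x => fderiv ℝ (chartMap f p) x (coordField Y p x)) _ x₀ :=
    hD.clm_apply hY.hasFDerivAt
  set G : M → Ambient r := fun q => push f q (Y q) with hG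
  have hGW : G ∘ (extChartAt (𝓡 4) p).symm =ᶠ[𝓝 x₀]
      fun x => fderiv ℝ (chartMap f p) x (coordField Y p x) := by
    filter_upwards [(isOpen_extChartAt_target (I := 𝓡 4) p).mem_nhds hx₀t] with x hx
    exact push_symm hf hx _
  have hGd : MDifferentiableAt (𝓡 4) (𝓡 (4 + r)) G p := by
    have hφ : MDifferentiableAt (𝓡 4) 𝓘(ℝ, EuclideanSpace ℝ (Fin 4)) (extChartAt (𝓡 4) p) p :=
      mdifferentiableAt_extChartAt (mem_chart_source _ p)
    refine (MDifferentiableAt.comp p hW.differentiableAt.mdifferentiableAt hφ).congr_of_eventuallyEq ?_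
    filter_upwards [extChartAt_source_mem_nhds (I := 𝓡 4) p] with q hq
    have hc : coordField Y p (extChartAt (𝓡 4) p q) = toCoord p q (Y q) := by
      rw [coordField, (extChartAt (𝓡 4) p).left_inv hq]
    refine (push_eq hf hq _).trans ?_
    rw [← hc]
    rfl
  have hGm : mfderiv (𝓡 4) (𝓡 (4 + r)) G p =
      fderiv ℝ (fun x => fderiv ℝ (chartMap f p) x (coordField Y p x)) x₀ := by
    have h1 : writtenInExtChartAt (𝓡 4) (𝓡 (4 + r)) p G = G ∘ (extChartAt (𝓡 4) p).symm := by
      ext1 x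
      simp [writtenInExtChartAt]
      rfl
    have h2 := hGd.mfderiv
    rw [h1, ModelWithCorners.range_eq_univ, fderivWithin_univ, hGW.fderiv_eq] at h2
    exact h2
  have hplane : tangentPlane f p = LinearMap.range (fderiv ℝ (chartMap f p) x₀).toLinearMap := by
    rw [tangentPlane, hpush]
    rfl
  have hproj : (tangentPlane f p).starProjection (mfderiv (𝓡 4) (𝓡 (4 + r)) G p u) =
      fderiv ℝ (chartMap f p) x₀ (fderiv ℝ (coordField Y p) x₀ u +
        christoffel (chartMap f p) x₀ u (coordField Y p x₀)) := by
    simp only [hplane]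
    rw [hGm, hW.fderiv]
    refine (starProjection_range hinj _).trans (congrArg _ ?_)
    have h1 := pinv_apply_self hinj (fderiv ℝ (coordField Y p) x₀ u)
    refine (map_add (pinv (fderiv ℝ (chartMap f p) x₀)) _ _).trans ?_
    exact congrArg₂ _ h1 rfl
  rw [leviCivita, hproj, ← hpush]
  exact Function.leftInverse_invFun (hf.2 p) _

theorem parallel_of_covDerivEnd_eq_zero (hf : IsSmoothImmersion f) {J : ∀ q : M, Tan q →L[ℝ] Tan q}
    (hJ : DifferentiableAt ℝ (coordEnd J p) (extChartAt (𝓡 4) p p))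
    (h0 : ∀ u y, covDerivEnd (chartMap f p) (coordEnd J p) (extChartAt (𝓡 4) p p) u y = 0)
    {Y : ∀ q : M, Tan q}
    (hY : DifferentiableAt ℝ (coordField Y p) (extChartAt (𝓡 4) p p)) (u : Tan p) :
    leviCivita f (fun q => J q (Y q)) p u = J p (leviCivita f Y p u) := by
  have hx₀t : extChartAt (𝓡 4) p p ∈ (extChartAt (𝓡 4) p).target := mem_extChartAt_target p
  have hJY : coordField (fun q => J q (Y q)) p =ᶠ[𝓝 (extChartAt (𝓡 4) p p)]
      fun x => coordEnd J p x (coordField Y p x) := by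
    filter_upwards [(isOpen_extChartAt_target (I := 𝓡 4) p).mem_nhds hx₀t] with x hx
    rw [coordEnd_apply, coordField, coordField, ofCoord_toCoord ((extChartAt (𝓡 4) p).map_target hx)]
  have hd : HasFDerivAt (fun x => coordEnd J p x (coordField Y p x)) _ (extChartAt (𝓡 4) p p) :=
    hJ.hasFDerivAt.clm_apply hY.hasFDerivAt
  have key : ∀ u : EuclideanSpace ℝ (Fin 4),
      fderiv ℝ (coordField (fun q => J q (Y q)) p) (extChartAt (𝓡 4) p p) u +
        christoffel (chartMap f p) (extChartAt (𝓡 4) p p) u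
          (coordField (fun q => J q (Y q)) p (extChartAt (𝓡 4) p p)) =
      coordEnd J p (extChartAt (𝓡 4) p p) (fderiv ℝ (coordField Y p) (extChartAt (𝓡 4) p p) u +
        christoffel (chartMap f p) (extChartAt (𝓡 4) p p) u
          (coordField Y p (extChartAt (𝓡 4) p p))) := fun u => by
    have h1 := h0 u (coordField Y p (extChartAt (𝓡 4) p p))
    rw [covDerivEnd, sub_eq_zero] at h1
    rw [hJY.fderiv_eq, hJY.self_of_nhds, hd.fderiv, map_add, ← h1]
    simp
    abel
  refine (leviCivita_eq hf (hd.differentiableAt.congr_of_eventuallyEq hJY) u).trans ?_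
  refine (key u).trans ((coordEnd_self J _).trans ?_)
  exact congrArg (J p) (leviCivita_eq hf hY u).symm

end Coordinates

/-! ### From the chart computations to the Kähler conclusions. -/

section Main

variable {M : Type*} [TopologicalSpace M] [ChartedSpace (EuclideanSpace ℝ (Fin 4)) M]
  [IsManifold (𝓡 4) ∞ M] {r : ℕ} {f : M → Ambient r} {p : M}

theorem IsAdapted.neg {E V : Type*} [NormedAddCommGroup E] [InnerProductSpace ℝ E]
    [FiniteDimensional ℝ E] [NormedAddCommGroup V] [InnerProductSpace ℝ V] [FiniteDimensional ℝ V]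
    {F : E → V} {x : E} {L : E →L[ℝ] E} (h : IsAdapted F x L) : IsAdapted F x (-L) :=
  ⟨fun y => by simp [h.sq_eq], fun y z => by simp [h.skew], fun ν hν y z => by
    simp [h.second ν hν]⟩

theorem isAdapted_coordEnd_frameJ (hf : IsSmoothImmersion f) {e : ∀ q : M, Fin 4 → Tan q}
    (he : ∀ q, IsTypeAFrame f q (e q)) {x : EuclideanSpace ℝ (Fin 4)}
    (hx : x ∈ (extChartAt (𝓡 4) p).target) :
    IsAdapted (chartMap f p) x (coordEnd (fun q => frameJ f q (e q)) p x) := by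
  rw [coordEnd_frameJ hf e hx]
  exact isAdapted_ofFrameMatrix_stdJ finrank_model (orthonormal_coordFrame hf he hx)
    fun ν hν => secondMatrix_mem_QA hf he hx hν

omit [IsManifold (𝓡 4) ∞ M] in
theorem eventually_symm_mem {U : Set M} (hU : U ∈ 𝓝 p) :
    ∀ᶠ x in 𝓝 (extChartAt (𝓡 4) p p),
      x ∈ (extChartAt (𝓡 4) p).target ∧ (extChartAt (𝓡 4) p).symm x ∈ U := by
  have h : ContinuousAt (extChartAt (𝓡 4) p).symm (extChartAt (𝓡 4) p p) :=
    continuousAt_extChartAt_symm p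
  exact Filter.inter_mem (extChartAt_target_mem_nhds p)
    (h.preimage_mem_nhds (by rwa [extChartAt_to_inv]))

theorem coordEnd_eq_or_neg {J J' : ∀ q : M, Tan q →L[ℝ] Tan q} {x : EuclideanSpace ℝ (Fin 4)}
    (h : J' ((extChartAt (𝓡 4) p).symm x) = J ((extChartAt (𝓡 4) p).symm x) ∨
      J' ((extChartAt (𝓡 4) p).symm x) = -J ((extChartAt (𝓡 4) p).symm x)) :
    coordEnd J' p x = coordEnd J p x ∨ coordEnd J' p x = -coordEnd J p x := by
  refine h.imp (fun h => ?_) fun h => ?_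
  · rw [coordEnd, h, coordEnd]
  · rw [coordEnd, h, coordEnd, ContinuousLinearMap.neg_comp, ContinuousLinearMap.comp_neg]

/-- All conditions other than smoothness are checked at `p` in its own chart, where `coordEnd` at
the base point is the endomorphism itself. -/
theorem isKaehlerOn_of_contMDiffAt (hf : IsSmoothImmersion f) {e : ∀ q : M, Fin 4 → Tan q}
    (he : ∀ q, IsTypeAFrame f q (e q))
    (hK : ∀ q, HasTrivialCommonNullspace (secondFormSpace f q (e q)))
    {J' : ∀ q : M, Tan q →L[ℝ] Tan q} {U : Set M} (hU : IsOpen U)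
    (hJ : ∀ q ∈ U, J' q = frameJ f q (e q) ∨ J' q = -frameJ f q (e q))
    (hs : ∀ q ∈ U, ContMDiffAt (𝓡 4)
      ((𝓡 4).prod 𝓘(ℝ, EuclideanSpace ℝ (Fin 4) →L[ℝ] EuclideanSpace ℝ (Fin 4))) ∞
      (endSection J') q) : IsKaehlerOn f J' U := by
  have hev : ∀ p ∈ U, ∀ᶠ x in 𝓝 (extChartAt (𝓡 4) p p),
      x ∈ (extChartAt (𝓡 4) p).target ∧ IsAdapted (chartMap f p) x (coordEnd J' p x) := by
    intro p hp
    filter_upwards [eventually_symm_mem (hU.mem_nhds hp)] with x hx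
    have h := isAdapted_coordEnd_frameJ hf he hx.1
    rcases coordEnd_eq_or_neg (J := fun q => frameJ f q (e q)) (hJ _ hx.2) with h1 | h1
    · exact ⟨hx.1, h1 ▸ h⟩
    · exact ⟨hx.1, h1 ▸ h.neg⟩
  refine ⟨fun q hq => (hs q hq).contMDiffWithinAt, fun p hp v => ?_, fun p hp u v => ?_,
    fun p hp Y hY u => ?_⟩
  · refine Eq.trans ?_ ((hev p hp).self_of_nhds.2.sq_eq v)
    exact ((coordEnd_self J' _).trans (congrArg (J' p) (coordEnd_self J' v))).symm
  · have hA := (hev p hp).self_of_nhds.2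
    have key : ∀ u v : EuclideanSpace ℝ (Fin 4),
        inner ℝ (fderiv ℝ (chartMap f p) (extChartAt (𝓡 4) p p)
            (coordEnd J' p (extChartAt (𝓡 4) p p) u))
          (fderiv ℝ (chartMap f p) (extChartAt (𝓡 4) p p)
            (coordEnd J' p (extChartAt (𝓡 4) p p) v)) =
        inner ℝ (fderiv ℝ (chartMap f p) (extChartAt (𝓡 4) p p) u)
          (fderiv ℝ (chartMap f p) (extChartAt (𝓡 4) p p) v) := fun u v => by
      rw [hA.skew, hA.sq_eq, map_neg, inner_neg_right, neg_neg]
    rw [push_eq_fderiv_self hf p]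
    refine Eq.trans ?_ (key u v)
    exact congrArg₂ (fun a b => inner ℝ (fderiv ℝ (chartMap f p) (extChartAt (𝓡 4) p p) a)
      (fderiv ℝ (chartMap f p) (extChartAt (𝓡 4) p p) b))
      (coordEnd_self J' u).symm (coordEnd_self J' v).symm
  · have hx₀ : extChartAt (𝓡 4) p p ∈ (extChartAt (𝓡 4) p).target := mem_extChartAt_target p
    have hsm := (contMDiffAt_endSection_iff J' (mem_extChartAt_source p)).mp (hs p hp)
    have hd := differentiableAt_of_contDiffAt_infty hsm
    have hb := orthonormal_coordFrame hf he hx₀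
    obtain ⟨s, hs0, hsJ⟩ : ∃ s : ℝ, s ≠ 0 ∧ coordEnd J' p (extChartAt (𝓡 4) p p) =
        s • coordEnd (fun q => frameJ f q (e q)) p (extChartAt (𝓡 4) p p) := by
      rcases coordEnd_eq_or_neg (J := fun q => frameJ f q (e q))
        (hJ _ (eventually_symm_mem (hU.mem_nhds hp)).self_of_nhds.2) with h1 | h1
      · exact ⟨1, one_ne_zero, by rw [h1, one_smul]⟩
      · exact ⟨-1, by norm_num, h1.trans (neg_one_smul ℝ _).symm⟩
    refine parallel_of_covDerivEnd_eq_zero hf hd (covDerivEnd_eq_zero finrank_model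
      (contDiffAt_chartMap hf hx₀) hd ((hev p hp).mono fun x hx => hx.2.sq_eq)
      ((hev p hp).mono fun x hx => hx.2.skew) ((hev p hp).mono fun x hx => ?_) hb hs0
      (fun j => ?_) (fun ν hν => secondMatrix_mem_QA hf he hx₀ hν)
      fun w hw => eq_zero_of_secondMatrix hf hx₀ hK w hw)
      (differentiableAt_of_contDiffAt_infty (contDiffAt_coordField hY)) u
    · have hinj := injective_fderiv_chartMap hf hx.1
      refine ⟨hinj, fun y z => ?_⟩
      set w := fderiv ℝ (fderiv ℝ (chartMap f p)) x (coordEnd J' p x y) z -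
        fderiv ℝ (fderiv ℝ (chartMap f p)) x y (coordEnd J' p x z) with hw
      -- Adaptedness makes `w` orthogonal to all normal vectors. Testing against the normal part of
      -- `w` itself shows that this part is zero, so `w` is tangential.
      have hν := inner_normalPart hinj w
      have h2 := hx.2.second _ hν y z
      have h3 : inner ℝ (w - fderiv ℝ (chartMap f p) x (pinv (fderiv ℝ (chartMap f p) x) w)) w
          = 0 := by
        conv_lhs => rw [hw]
        rw [inner_sub_right, ← hw, h2, sub_self]
      refine ⟨pinv (fderiv ℝ (chartMap f p) x) w,
        sub_eq_zero.mp (inner_self_eq_zero (𝕜 := ℝ).mp ?_)⟩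
      rw [inner_sub_right, h3, hν, sub_zero]
    · rw [hsJ, coordEnd_frameJ hf e hx₀, smul_apply, ofFrameMatrix_frame hb]

theorem exists_smooth_coordEnd (hf : IsSmoothImmersion f) {e : ∀ q : M, Fin 4 → Tan q}
    (he : ∀ q, IsTypeAFrame f q (e q))
    (hK : ∀ q, HasTrivialCommonNullspace (secondFormSpace f q (e q)))
    (hpf : ∀ᶠ x in 𝓝 (extChartAt (𝓡 4) p p), pfaffian (frameMatrix (chartMap f p) x
      (smoothFrame (chartMap f p) (coordFrame e p (extChartAt (𝓡 4) p p)) x)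
      (coordEnd (fun q => frameJ f q (e q)) p x)) < 0) :
    ∃ L : EuclideanSpace ℝ (Fin 4) → EuclideanSpace ℝ (Fin 4) →L[ℝ] EuclideanSpace ℝ (Fin 4),
      (∀ᶠ x in 𝓝 (extChartAt (𝓡 4) p p), ContDiffAt ℝ ∞ L x ∧
        (L x = coordEnd (fun q => frameJ f q (e q)) p x ∨
          L x = -coordEnd (fun q => frameJ f q (e q)) p x)) ∧
      (ContinuousAt (coordEnd (fun q => frameJ f q (e q)) p) (extChartAt (𝓡 4) p p) →
        ∀ᶠ x in 𝓝 (extChartAt (𝓡 4) p p), L x = coordEnd (fun q => frameJ f q (e q)) p x) := by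
  have hx₀ : extChartAt (𝓡 4) p p ∈ (extChartAt (𝓡 4) p).target := mem_extChartAt_target p
  have ht := extChartAt_target_mem_nhds (I := 𝓡 4) p
  refine exists_smooth_adapted finrank_model ?_ ?_ (orthonormal_coordFrame hf he hx₀)
    (coordEnd_frameJ hf e hx₀) (fun ν hν => secondMatrix_mem_QA hf he hx₀ hν)
    (fun w hw => eq_zero_of_secondMatrix hf hx₀ hK w hw) hpf
  · filter_upwards [ht] with x hx
    exact ⟨contDiffAt_chartMap hf hx, injective_fderiv_chartMap hf hx⟩
  · filter_upwards [ht] with x hx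
    exact isAdapted_coordEnd_frameJ hf he hx

theorem isKaehlerOn_univ_of_continuous (hf : IsSmoothImmersion f) {e : ∀ q : M, Fin 4 → Tan q}
    (he : ∀ q, IsTypeAFrame f q (e q))
    (hK : ∀ q, HasTrivialCommonNullspace (secondFormSpace f q (e q)))
    (hc : Continuous (endSection fun q => frameJ f q (e q))) :
    IsKaehlerOn f (fun q => frameJ f q (e q)) Set.univ := by
  refine isKaehlerOn_of_contMDiffAt hf he hK isOpen_univ (fun q _ => Or.inl rfl) fun p _ => ?_
  have hx₀ : extChartAt (𝓡 4) p p ∈ (extChartAt (𝓡 4) p).target := mem_extChartAt_target p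
  have hcp := continuousAt_coordEnd (hc.continuousAt (x := p))
  obtain ⟨L, h1, h2⟩ := exists_smooth_coordEnd (p := p) hf he hK
    (pfaffian_neg_of_continuousAt (contDiffAt_chartMap hf hx₀) (injective_fderiv_chartMap hf hx₀)
      (orthonormal_coordFrame hf he hx₀) (coordEnd_frameJ hf e hx₀) hcp)
  rw [contMDiffAt_endSection_iff _ (mem_extChartAt_source p)]
  exact h1.self_of_nhds.1.congr_of_eventuallyEq ((h2 hcp).mono fun x hx => hx.symm)

theorem LocallyCooriented.pfaffian_neg (hf : IsSmoothImmersion f) {e : ∀ q : M, Fin 4 → Tan q}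
    (he : ∀ q, IsTypeAFrame f q (e q)) (hor : LocallyCooriented f e) (p : M) :
    ∀ᶠ x in 𝓝 (extChartAt (𝓡 4) p p), pfaffian (frameMatrix (chartMap f p) x
      (smoothFrame (chartMap f p) (coordFrame e p (extChartAt (𝓡 4) p p)) x)
      (coordEnd (fun q => frameJ f q (e q)) p x)) < 0 := by
  have ht := extChartAt_target_mem_nhds (I := 𝓡 4) p
  have h : ∀ i, push f p (e p i) = fderiv ℝ (chartMap f p) (extChartAt (𝓡 4) p p)
      (coordFrame e p (extChartAt (𝓡 4) p p) i) := fun i => by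
    rw [coordFrame, ← push_symm hf (mem_extChartAt_target p), extChartAt_to_inv]
  have hp := pfaffian_neg_of_det_pos (F := chartMap f p) (x := extChartAt (𝓡 4) p p)
    finrank_model (e := coordFrame e p)
    (by
      filter_upwards [ht] with x hx
      exact ⟨contDiffAt_chartMap hf hx, injective_fderiv_chartMap hf hx⟩)
    (by
      filter_upwards [ht] with x hx
      exact orthonormal_coordFrame hf he hx)
    (by
      filter_upwards [eventually_symm_mem (hor p)] with x hx
      have h2 := hx.2
      simp only [h, push_symm hf hx.1] at h2
      exact h2)
  filter_upwards [hp, ht] with x hx hxt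
  rwa [coordEnd_frameJ hf e hxt]

theorem exists_isKaehlerOn_of_locallyCooriented (hf : IsSmoothImmersion f)
    {e : ∀ q : M, Fin 4 → Tan q} (he : ∀ q, IsTypeAFrame f q (e q))
    (hK : ∀ q, HasTrivialCommonNullspace (secondFormSpace f q (e q)))
    (hor : LocallyCooriented f e) (p : M) :
    ∃ (U : Set M) (J' : ∀ q : M, Tan q →L[ℝ] Tan q), IsOpen U ∧ p ∈ U ∧
      (∀ q ∈ U, J' q = frameJ f q (e q) ∨ J' q = -frameJ f q (e q)) ∧ IsKaehlerOn f J' U := by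
  obtain ⟨L, h1, -⟩ := exists_smooth_coordEnd hf he hK (hor.pfaffian_neg hf he p)
  obtain ⟨W, hW, hWo, hpW⟩ := eventually_nhds_iff.mp h1
  -- The field `L` is carried back through the chart at `p`; values away from the chart domain are
  -- irrelevant, since only the open set below is used.
  let J' : ∀ q : M, Tan q →L[ℝ] Tan q := fun q =>
    (ofCoord p q).comp ((L (extChartAt (𝓡 4) p q)).comp (toCoord p q))
  have hUo : IsOpen ((extChartAt (𝓡 4) p).source ∩ extChartAt (𝓡 4) p ⁻¹' W) :=
    (continuousOn_extChartAt p).isOpen_inter_preimage (isOpen_extChartAt_source p) hWo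
  have hJ : ∀ q ∈ (extChartAt (𝓡 4) p).source ∩ extChartAt (𝓡 4) p ⁻¹' W,
      J' q = frameJ f q (e q) ∨ J' q = -frameJ f q (e q) := fun q hq => by
    have h2 : ∀ v : Tan q, coordEnd (fun q => frameJ f q (e q)) p (extChartAt (𝓡 4) p q)
        (toCoord p q v) = toCoord p q (frameJ f q (e q) v) := fun v => by
      rw [coordEnd, (extChartAt (𝓡 4) p).left_inv hq.1]
      exact congrArg (fun z => toCoord p q (frameJ f q (e q) z)) (ofCoord_toCoord hq.1 v)
    refine (hW _ hq.2).2.imp (fun h => ?_) fun h => ?_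
    · ext1 v
      change ofCoord p q (L (extChartAt (𝓡 4) p q) (toCoord p q v)) = _
      rw [h, h2, ofCoord_toCoord hq.1]
    · ext1 v
      change ofCoord p q (L (extChartAt (𝓡 4) p q) (toCoord p q v)) = -frameJ f q (e q) v
      rw [h, neg_apply, h2, map_neg, ofCoord_toCoord hq.1]
  refine ⟨_, J', hUo, ⟨mem_extChartAt_source p, hpW⟩, hJ,
    isKaehlerOn_of_contMDiffAt hf he hK hUo hJ fun q hq => ?_⟩
  rw [contMDiffAt_endSection_iff J' hq.1]
  refine (hW _ hq.2).1.congr_of_eventuallyEq ?_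
  filter_upwards [(isOpen_extChartAt_target (I := 𝓡 4) p).mem_nhds
    ((extChartAt (𝓡 4) p).map_source hq.1)] with x hx
  ext1 y
  have hq' := (extChartAt (𝓡 4) p).map_target hx
  rw [coordEnd_apply]
  change toCoord p _ (ofCoord p _ (L (extChartAt (𝓡 4) p ((extChartAt (𝓡 4) p).symm x))
    (toCoord p _ (ofCoord p _ y)))) = _
  rw [toCoord_ofCoord hq', toCoord_ofCoord hq', (extChartAt (𝓡 4) p).right_inv hx]

end Main

end

end AustereFourfold

theorem mainTheorem10 {M : Type*} [TopologicalSpace M]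
    [ChartedSpace (EuclideanSpace ℝ (Fin 4)) M] [IsManifold (𝓡 4) ∞ M] (r : ℕ)
    (f : M → AustereFourfold.Ambient r) (hf : AustereFourfold.IsSmoothImmersion f)
    (hA : AustereFourfold.IsTypeA f)
    (e : ∀ p : M, Fin 4 → AustereFourfold.Tan p)
    (he : ∀ p, AustereFourfold.IsTypeAFrame f p (e p))
    (hK : ∀ p, AustereFourfold.HasTrivialCommonNullspace
      (AustereFourfold.secondFormSpace f p (e p))) :
    (Continuous (AustereFourfold.endSection fun p => AustereFourfold.frameJ f p (e p)) →
      AustereFourfold.IsKaehlerOn f (fun p => AustereFourfold.frameJ f p (e p)) Set.univ) ∧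
    (AustereFourfold.LocallyCooriented f e →
      ∀ p : M, ∃ (U : Set M) (J' : ∀ q : M, AustereFourfold.Tan q →L[ℝ] AustereFourfold.Tan q),
        IsOpen U ∧ p ∈ U ∧
        (∀ q ∈ U, J' q = AustereFourfold.frameJ f q (e q) ∨
          J' q = -AustereFourfold.frameJ f q (e q)) ∧
        AustereFourfold.IsKaehlerOn f J' U) :=
  ⟨AustereFourfold.isKaehlerOn_univ_of_continuous hf he hK,
    AustereFourfold.exists_isKaehlerOn_of_locallyCooriented hf he hK⟩
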